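/- Let $K$ be a field of characteristic zero, $n \ge 0$, $R = K[x_1,\dots,x_n]$, and let $D_n$ be the $n$-th Weyl algebra over $K$, i.e. the ring generated over $K$ by $x_1,\dots,x_n,\partial_1,\dots,\partial_n$ with relations $x_ix_j = x_jx_i$, $\partial_i\partial_j=\partial_j\partial_i$, $\partial_i x_j = x_j\partial_i + \delta_{ij}$. Let $f \in R$ be a product of finitely many polynomials $h_i$ of degree one (not necessarily homogeneous), no two of which are proportional over $K$, and let $\mathcal{A} = \{H_i\}$, $H_i = \{v \in K^n \mid h_i(v) = 0\}$, be the (affine) hyperplane arrangement in $V = K^n$ that it defines. Regard the localization $R_f = R[f^{-1}]$ and its quotient $H^1_{(f)}(R) = R_f/R$ as left $D_n$-modules in the natural way ($x_i$ acts by multiplication, $\partial_i$ as the unique extension of $\partial/\partial x_i$ to a derivation of $R_f$). Let $L(\mathcal{A})$ be the set of all non-empty intersections of members of $\mathcal{A}$ (including $V$, the intersection of no members), ordered by $X \le Y \iff X \supseteq Y$; let $\mu$ be its Möbius function ($\mu(X,X) = 1$ and $\mu(X,Y) = -\sum_{X \le Z < Y}\mu(X,Z)$ for $X<Y$), put $\mu(X)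 = \mu(V,X)$, and let $$\pi(\mathcal{A},t) = \sum_{X \in L(\mathcal{A})} \mu(X)\,(-t)^{\operatorname{codim} X}$$ be the Poincaré polynomial of $\mathcal{A}$. Then $H^1_{(f)}(R)$ has finite length as a left $D_n$-module, and $$\operatorname{length} H^1_{(f)}(R) = \pi(\mathcal{A},1) - 1 = \sum_{X \in L(\mathcal{A})\setminus\{V\}} |\mu(X)| .$$ -/

import Mathlib

/-! ### The Weyl algebra -/

/-- Defining relations of the `n`-th Weyl algebra. The generator `Sum.inl i` stands for the
variable `x_i` and the generator `Sum.inr i` for the partial derivation `∂_i`. -/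
inductive WeylAlgebra.Rel (K : Type*) [Field K] (n : ℕ) :
    FreeAlgebra K (Fin n ⊕ Fin n) → FreeAlgebra K (Fin n ⊕ Fin n) → Prop
  | x_comm (i j : Fin n) :
      Rel K n (FreeAlgebra.ι K (Sum.inl i) * FreeAlgebra.ι K (Sum.inl j))
        (FreeAlgebra.ι K (Sum.inl j) * FreeAlgebra.ι K (Sum.inl i))
  | d_comm (i j : Fin n) :
      Rel K n (FreeAlgebra.ι K (Sum.inr i) * FreeAlgebra.ι K (Sum.inr j))
        (FreeAlgebra.ι K (Sum.inr j) * FreeAlgebra.ι K (Sum.inr i))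
  | d_x (i j : Fin n) :
      Rel K n (FreeAlgebra.ι K (Sum.inr i) * FreeAlgebra.ι K (Sum.inl j))
        (FreeAlgebra.ι K (Sum.inl j) * FreeAlgebra.ι K (Sum.inr i) + if i = j then 1 else 0)

/-- The `n`-th Weyl algebra `D_n` over the field `K`: the `K`-algebra generated by
`x_1, …, x_n, ∂_1, …, ∂_n` with `x_i x_j = x_j x_i`, `∂_i ∂_j = ∂_j ∂_i` and
`∂_i x_j = x_j ∂_i + δ_{ij}`. -/
def WeylAlgebra (K : Type*) [Field K] (n : ℕ) : Type _ :=
  RingQuot (WeylAlgebra.Rel K n)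

namespace WeylAlgebra

variable (K : Type*) [Field K] (n : ℕ)

noncomputable instance : Ring (WeylAlgebra K n) :=
  inferInstanceAs (Ring (RingQuot (WeylAlgebra.Rel K n)))

noncomputable instance : Algebra K (WeylAlgebra K n) :=
  inferInstanceAs (Algebra K (RingQuot (WeylAlgebra.Rel K n)))

/-- The quotient map from the free algebra onto the Weyl algebra. -/
noncomputable def mk : FreeAlgebra K (Fin n ⊕ Fin n) →ₐ[K] WeylAlgebra K n :=
  RingQuot.mkAlgHom K (WeylAlgebra.Rel K n)

/-- The element `x_i` of the Weyl algebra. -/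
noncomputable def x (i : Fin n) : WeylAlgebra K n :=
  mk K n (FreeAlgebra.ι K (Sum.inl i))

/-- The element `∂_i` of the Weyl algebra. -/
noncomputable def d (i : Fin n) : WeylAlgebra K n :=
  mk K n (FreeAlgebra.ι K (Sum.inr i))

theorem mk_surjective : Function.Surjective (mk K n) :=
  RingQuot.mkAlgHom_surjective K (WeylAlgebra.Rel K n)

end WeylAlgebra

/-! ### The partial derivations on `R_f` -/

section Localization

variable {K : Type*} [Field K] {n : ℕ} (f : MvPolynomial (Fin n) K)

/-- The homomorphism `p ↦ p + ε ∂_i p` from `R` to the dual numbers over `R_f`. -/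
noncomputable def dualNumberHom (i : Fin n) :
    MvPolynomial (Fin n) K →ₐ[K]
      TrivSqZeroExt (Localization.Away f) (Localization.Away f) where
  toFun p := TrivSqZeroExt.inl (algebraMap _ (Localization.Away f) p) +
    TrivSqZeroExt.inr (algebraMap _ (Localization.Away f) (MvPolynomial.pderiv i p))
  map_one' := by simp
  map_mul' p q := by
    apply TrivSqZeroExt.ext
    · simp only [TrivSqZeroExt.fst_add, TrivSqZeroExt.fst_inl, TrivSqZeroExt.fst_inr,
        TrivSqZeroExt.fst_mul, map_mul, add_zero]
    · simp only [TrivSqZeroExt.snd_add, TrivSqZeroExt.snd_inl, TrivSqZeroExt.snd_inr,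
        TrivSqZeroExt.fst_add, TrivSqZeroExt.fst_inl, TrivSqZeroExt.fst_inr,
        TrivSqZeroExt.snd_mul, map_mul, map_add, add_zero, zero_add, Derivation.leibniz,
        smul_eq_mul, MulOpposite.smul_eq_mul_unop, MulOpposite.unop_op]
      ring
  map_zero' := by simp
  map_add' p q := by
    simp only [map_add, TrivSqZeroExt.inl_add, TrivSqZeroExt.inr_add]
    abel
  commutes' c := by
    rw [Derivation.map_algebraMap, map_zero,
      TrivSqZeroExt.inr_zero, add_zero, ← IsScalarTower.algebraMap_apply]
    rfl

theorem fst_dualNumberHom (i : Fin n) (p : MvPolynomial (Fin n) K) :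
    (dualNumberHom f i p).fst = algebraMap _ (Localization.Away f) p :=
  add_zero _

theorem snd_dualNumberHom (i : Fin n) (p : MvPolynomial (Fin n) K) :
    (dualNumberHom f i p).snd =
      algebraMap _ (Localization.Away f) (MvPolynomial.pderiv i p) :=
  zero_add _

theorem isUnit_dualNumberHom (i : Fin n) (y : Submonoid.powers f) :
    IsUnit (dualNumberHom f i y) := by
  rw [TrivSqZeroExt.isUnit_iff_isUnit_fst]
  rw [fst_dualNumberHom]
  exact IsLocalization.map_units (Localization.Away f) y

/-- The extension of `dualNumberHom` to `R_f`. -/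
noncomputable def dualNumberLift (i : Fin n) :
    Localization.Away f →ₐ[K] TrivSqZeroExt (Localization.Away f) (Localization.Away f) :=
  IsLocalization.liftAlgHom (M := Submonoid.powers f) (f := dualNumberHom f i)
    (isUnit_dualNumberHom f i)

theorem dualNumberLift_algebraMap (i : Fin n) (p : MvPolynomial (Fin n) K) :
    dualNumberLift f i (algebraMap _ _ p) = dualNumberHom f i p := by
  simp [dualNumberLift]

theorem fst_dualNumberLift (i : Fin n) (u : Localization.Away f) :
    (dualNumberLift f i u).fst = u := by
  have h : ((TrivSqZeroExt.fstHom K (Localization.Away f) (Localization.Away f)).comp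
      (dualNumberLift f i)).toRingHom = RingHom.id _ := by
    apply IsLocalization.ringHom_ext (Submonoid.powers f)
    apply RingHom.ext
    intro p
    change (dualNumberLift f i (algebraMap _ _ p)).fst = algebraMap _ _ p
    rw [dualNumberLift_algebraMap, fst_dualNumberHom]
  exact RingHom.congr_fun h u

/-- The derivation `∂_i` of `R_f`: the unique extension of the partial derivation `∂/∂x_i` of
the polynomial ring `R`. -/
noncomputable def partialAway (i : Fin n) :
    Derivation K (Localization.Away f) (Localization.Away f) :=
  Derivation.mk' ((TrivSqZeroExt.sndHom (Localization.Away f)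
      (Localization.Away f)).restrictScalars K ∘ₗ (dualNumberLift f i).toLinearMap)
    (fun a b => by
      simp [fst_dualNumberLift]
      ring)

theorem partialAway_algebraMap (i : Fin n) (p : MvPolynomial (Fin n) K) :
    partialAway f i (algebraMap _ _ p) = algebraMap _ _ (MvPolynomial.pderiv i p) := by
  change (dualNumberLift f i (algebraMap _ _ p)).snd = _
  rw [dualNumberLift_algebraMap, snd_dualNumberHom]

theorem derivation_away_ext {D₁ D₂ : Derivation K (Localization.Away f) (Localization.Away f)}
    (h : ∀ p : MvPolynomial (Fin n) K, D₁ (algebraMap _ _ p) = D₂ (algebraMap _ _ p)) :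
    D₁ = D₂ := by
  ext u
  obtain ⟨⟨a, s⟩, hu⟩ := IsLocalization.surj (Submonoid.powers f) u
  have h₁ := congrArg D₁ hu
  have h₂ := congrArg D₂ hu
  simp only [Derivation.leibniz, smul_eq_mul, h] at h₁ h₂
  have h₃ := add_left_cancel (h₁.trans h₂.symm)
  exact (IsLocalization.map_units (Localization.Away f) s).mul_left_cancel h₃

theorem partialAway_comm (i j : Fin n) (u : Localization.Away f) :
    partialAway f i (partialAway f j u) = partialAway f j (partialAway f i u) := by
  have h : ⁅partialAway f i, partialAway f j⁆ = 0 := by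
    apply derivation_away_ext
    intro p
    simp only [Derivation.commutator_apply, partialAway_algebraMap, Derivation.zero_apply,
      ← map_sub]
    have h₀ : ⁅(MvPolynomial.pderiv i : Derivation K (MvPolynomial (Fin n) K) _),
        (MvPolynomial.pderiv j : Derivation K (MvPolynomial (Fin n) K) _)⁆ = 0 := by
      apply MvPolynomial.derivation_ext
      intro k
      simp [Derivation.commutator_apply, MvPolynomial.pderiv_X, Pi.single_apply, apply_ite]
    rw [← Derivation.commutator_apply, h₀, Derivation.zero_apply, map_zero]
  have h' := Derivation.congr_fun h u
  rw [Derivation.commutator_apply, Derivation.zero_apply, sub_eq_zero] at h'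
  exact h'

/-! ### The left `D_n`-module structure on `R_f` and `R_f / R` -/

/-- The action of the generators of the Weyl algebra on `R_f`: `x_i` acts by multiplication and
`∂_i` by derivation. -/
noncomputable def generatorAction :
    Fin n ⊕ Fin n → Module.End K (Localization.Away f)
  | Sum.inl i => LinearMap.mulLeft K
      (algebraMap (MvPolynomial (Fin n) K) (Localization.Away f) (MvPolynomial.X i))
  | Sum.inr i => (partialAway f i : Localization.Away f →ₗ[K] Localization.Away f)

/-- The action of the Weyl algebra on `R_f`. -/
noncomputable def weylAction : WeylAlgebra K n →ₐ[K] Module.End K (Localization.Away f) :=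
  RingQuot.liftAlgHom K ⟨FreeAlgebra.lift K (generatorAction f), by
    rintro _ _ (⟨i, j⟩ | ⟨i, j⟩ | ⟨i, j⟩)
    · ext u
      simp [generatorAction]
      ring
    · ext u
      simp [generatorAction, partialAway_comm f i j]
    · ext u
      by_cases hij : i = j
      · subst hij
        simp [generatorAction, partialAway_algebraMap]
      · simp [generatorAction, partialAway_algebraMap, hij,
          MvPolynomial.pderiv_X_of_ne (Ne.symm hij)]⟩

/-- The left `D_n`-module structure on `R_f`. -/
noncomputable instance : Module (WeylAlgebra K n) (Localization.Away f) :=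
  Module.compHom _ (weylAction f).toRingHom

theorem weyl_smul_def (P : WeylAlgebra K n) (u : Localization.Away f) :
    P • u = weylAction f P u := rfl

theorem weylAction_mk (a : FreeAlgebra K (Fin n ⊕ Fin n)) :
    weylAction f (WeylAlgebra.mk K n a) = FreeAlgebra.lift K (generatorAction f) a := by
  exact RingQuot.liftAlgHom_mkAlgHom_apply K _ _ a

theorem x_smul (i : Fin n) (u : Localization.Away f) :
    WeylAlgebra.x K n i • u =
      algebraMap (MvPolynomial (Fin n) K) _ (MvPolynomial.X i) * u := by
  simp [weyl_smul_def, WeylAlgebra.x, weylAction_mk, generatorAction]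

theorem d_smul (i : Fin n) (u : Localization.Away f) :
    WeylAlgebra.d K n i • u = partialAway f i u := by
  simp [weyl_smul_def, WeylAlgebra.d, weylAction_mk, generatorAction]

/-- The polynomial ring `R` (that is, its image in `R_f`) as a left `D_n`-submodule of `R_f`. -/
noncomputable def polynomialSubmodule : Submodule (WeylAlgebra K n) (Localization.Away f) where
  carrier := Set.range (algebraMap (MvPolynomial (Fin n) K) (Localization.Away f))
  add_mem' := by
    rintro _ _ ⟨p, rfl⟩ ⟨q, rfl⟩
    exact ⟨p + q, map_add _ _ _⟩
  zero_mem' := ⟨0, map_zero _⟩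
  smul_mem' := by
    intro P u hu
    obtain ⟨a, rfl⟩ := WeylAlgebra.mk_surjective K n P
    rw [weyl_smul_def, weylAction_mk]
    induction a using FreeAlgebra.induction generalizing u with
    | grade0 c =>
      obtain ⟨p, rfl⟩ := hu
      refine ⟨c • p, ?_⟩
      simp [Algebra.smul_def, IsScalarTower.algebraMap_apply K
        (MvPolynomial (Fin n) K) (Localization.Away f)]
    | grade1 s =>
      obtain ⟨p, rfl⟩ := hu
      rcases s with i | i
      · exact ⟨MvPolynomial.X i * p, by simp [generatorAction]⟩
      · exact ⟨MvPolynomial.pderiv i p, by simp [generatorAction, partialAway_algebraMap]⟩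
    | mul a b ha hb =>
      rw [map_mul, Module.End.mul_apply]
      exact ha (hb hu)
    | add a b ha hb =>
      rw [map_add, LinearMap.add_apply]
      obtain ⟨p, hp⟩ := ha hu
      obtain ⟨q, hq⟩ := hb hu
      exact ⟨p + q, by rw [map_add, hp, hq]⟩

/-- The first local cohomology group `H^1_{(f)}(R) = R_f / R`, a left `D_n`-module. -/
abbrev FirstLocalCohomology : Type _ :=
  Localization.Away f ⧸ polynomialSubmodule f

end Localization

/-! ### Hyperplane arrangements -/

/-- The intersection poset `L(A)` of a family `A` of subsets of `V`: all non-empty intersections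
of members of `A`. The empty intersection, `V` itself, is included. -/
def IntersectionPoset {V : Type*} (A : Set (Set V)) : Type _ :=
  {X : Set V // X.Nonempty ∧ ∃ S ⊆ A, X = ⋂₀ S}

namespace IntersectionPoset

variable {V : Type*} (A : Set (Set V))

/-- The order on the intersection poset is reverse inclusion. -/
instance : PartialOrder (IntersectionPoset A) :=
  PartialOrder.lift (fun X => OrderDual.toDual X.1) (fun _ _ h => Subtype.ext h)

theorem le_iff {X Y : IntersectionPoset A} : X ≤ Y ↔ Y.1 ⊆ X.1 := Iff.rfl

/-- The least element of the intersection poset is `V`. -/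
instance [Nonempty V] : OrderBot (IntersectionPoset A) where
  bot := ⟨Set.univ, Set.univ_nonempty, ∅, Set.empty_subset A, Set.sInter_empty.symm⟩
  bot_le X := Set.subset_univ X.1

theorem coe_bot [Nonempty V] : (⊥ : IntersectionPoset A).1 = Set.univ := rfl

instance [Finite A] : Finite (IntersectionPoset A) := by
  have hA : A.Finite := Set.toFinite A
  have h : {X : Set V | X.Nonempty ∧ ∃ S ⊆ A, X = ⋂₀ S}.Finite := by
    refine (hA.finite_subsets.image Set.sInter).subset ?_
    rintro X ⟨-, S, hS, rfl⟩
    exact ⟨S, hS, rfl⟩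
  exact h.to_subtype

noncomputable instance [Finite A] : Fintype (IntersectionPoset A) := Fintype.ofFinite _

noncomputable instance : DecidableEq (IntersectionPoset A) := Classical.decEq _

open Classical in
noncomputable instance [Finite A] : LocallyFiniteOrder (IntersectionPoset A) :=
  Fintype.toLocallyFiniteOrder

variable {A}

/-- `μ(X) = μ(V, X)`, where `μ` is the Möbius function of the intersection poset. -/
noncomputable def moebius [Nonempty V] [Finite A] (X : IntersectionPoset A) : ℤ :=
  IncidenceAlgebra.mu ℤ ⊥ X

/-- The codimension of a member of the intersection poset of an arrangement in a vector space:
the dimension of `V` modulo the direction of the affine subspace `X`. -/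
noncomputable def codim (K : Type*) {V : Type*} [Field K] [AddCommGroup V] [Module K V]
    {A : Set (Set V)} (X : IntersectionPoset A) : ℕ :=
  Module.finrank K (V ⧸ vectorSpan K X.1)

end IntersectionPoset

/-- The Poincaré polynomial `π(A, t) = ∑_{X ∈ L(A)} μ(X) (-t)^{codim X}`. -/
noncomputable def poincarePolynomial (K : Type*) {V : Type*} [Field K] [AddCommGroup V]
    [Module K V] (A : Set (Set V)) [Finite A] : Polynomial ℤ :=
  ∑ X : IntersectionPoset A, Polynomial.C X.moebius * (-Polynomial.X) ^ X.codim K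

/-- The set of hyperplanes `{v ∈ K^n | h_i(v) = 0}` defined by a family of polynomials of degree
one. -/
abbrev arrangement {K : Type*} [Field K] {n : ℕ} {ι : Type*}
    (h : ι → MvPolynomial (Fin n) K) : Set (Set (Fin n → K)) :=
  Set.range fun i => {v : Fin n → K | MvPolynomial.eval v (h i) = 0}

/-!
Write `R = K[x₁, …, xₙ]`. The length of `R_f` over the Weyl algebra and the value `π(𝒜, 1)` satisfy
the same deletion–restriction recursion. Subtracting the simple submodule `R` of `R_f` then gives
the length of `R_f / R`.

*Modules.* For a flat `X`, consider modules `N` that look like the localization, at a product of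
affine forms, of the `D_n`-module generated by the delta function `δ` of `X`
(`IsLocalizedVacuum`); `R_f` is of this kind with `X = V` and `δ = 1`. Choose affine coordinates
adapted to `X` (`AffineFrame`). The coordinates vanishing on `X` and the vector fields along `X`
kill `δ`, and they act on `D_n δ = {p(b) δ}` as signed partial derivatives in the complementary
generators `b`. In characteristic zero `δ` is therefore recovered from any nonzero element, and
`D_n δ` is simple (`AffineFrame.IsVacuum.isSimpleModule_span`). Working with delta functions inside
`D_n` avoids passing to Weyl algebras in fewer variables.

Add a hyperplane `H = {h = 0}`. If `H` contains `X`, then `N = 0`. If `H` misses `X`, then `h`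
already acts invertibly. Otherwise the part of `N` without poles along `H` is a submodule of the same
kind, for the same `X` and without `H`; the quotient by it is of the same kind for `X ∩ H`, with the
class of `h⁻¹ δ` as its delta function (`IsLocalizedVacuum.quotient_saturation`). The essential
point is that this class is nonzero unless a remaining hyperplane contains `X ∩ H`, which holds
because `X ∩ H` is irreducible (`IsLocalizedVacuum.notMem_saturation`).

*Combinatorics.* By Whitney's theorem (`IntersectionPoset.moebius_eq_sum`), `π(𝒜, 1)` is the sum of
`(-1) ^ (|B| + codim ⋂ B)` over the sets `B` of hyperplanes with non-empty intersection. This sum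
(`flatSum`) visibly satisfies the recursion (`flatSum_insert`). The same recursion, applied to the
sets `B` with one prescribed intersection `Y`, shows that `μ(Y) (-1) ^ codim Y` is nonnegative,
hence equal to `|μ(Y)|`.
-/

/-! ### Polynomials in commuting elements -/

namespace MvPolynomial

section CommEval

variable {K : Type*} [Field K] {σ : Type*} {A : Type*} [Ring A] [Algebra K A]

open scoped IsMulCommutative in
/-- Evaluation of polynomials at a family of pairwise commuting elements of a possibly
non-commutative algebra. It factors through the commutative subalgebra that they generate. -/
noncomputable def commEval (b : σ → A) (hb : ∀ i j, b i * b j = b j * b i) :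
    MvPolynomial σ K →ₐ[K] A :=
  haveI := Algebra.isMulCommutative_adjoin K (s := Set.range b)
    (by rintro _ ⟨i, rfl⟩ _ ⟨j, rfl⟩; exact hb i j)
  (Algebra.adjoin K (Set.range b)).val.comp
    (aeval fun i => (⟨b i, Algebra.subset_adjoin ⟨i, rfl⟩⟩ : Algebra.adjoin K (Set.range b)))

variable {b : σ → A} (hb : ∀ i j, b i * b j = b j * b i)

@[simp]
theorem commEval_X (i : σ) : commEval (K := K) b hb (X i) = b i := by
  simp [commEval]

@[simp]
theorem commEval_C (c : K) : commEval b hb (C c) = algebraMap K A c :=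
  AlgHom.commutes (commEval b hb) c

/-- An element whose commutators with the `b j` are scalars acts on polynomials in the `b j` as a
partial derivative. -/
theorem mul_commEval [DecidableEq σ] {a : A} {i : σ} {ε : K}
    (ha : ∀ j, a * b j = b j * a + if i = j then algebraMap K A ε else 0)
    (p : MvPolynomial σ K) :
    a * commEval b hb p =
      commEval b hb p * a + algebraMap K A ε * commEval b hb (pderiv i p) := by
  induction p using MvPolynomial.induction_on with
  | C c => simp [(Algebra.commutes c a).symm]
  | add p q hp hq => simp only [map_add, mul_add, add_mul, hp, hq]; abel
  | mul_X p j hp =>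
    rw [map_mul, ← mul_assoc, hp, commEval_X, add_mul, mul_assoc, ha j, Derivation.leibniz,
      smul_eq_mul, smul_eq_mul, map_add, map_mul, map_mul, commEval_X]
    have hcomm : commEval b hb (pderiv i p) * b j = b j * commEval b hb (pderiv i p) := by
      rw [← commEval_X (K := K) hb j, ← map_mul, ← map_mul, mul_comm]
    by_cases hij : i = j
    · subst hij
      rw [pderiv_X_self, map_one, mul_one, if_pos rfl, mul_assoc (algebraMap K A ε), hcomm,
        mul_add, mul_add, mul_assoc, ← Algebra.commutes ε]
      abel
    · rw [if_neg hij, pderiv_X_of_ne (Ne.symm hij), map_zero, mul_zero, zero_add, add_zero,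
        mul_assoc (algebraMap K A ε), hcomm, mul_assoc]

end CommEval

section Derivatives

variable {K : Type*} [Field K] {σ : Type*}

theorem totalDegree_pderiv_lt {p : MvPolynomial σ K} {i : σ} (h : pderiv i p ≠ 0) :
    (pderiv i p).totalDegree < p.totalDegree := by
  obtain ⟨m, hm, hdeg⟩ := Finset.exists_mem_eq_sup _ (support_nonempty.mpr h)
    (fun s : σ →₀ ℕ => s.sum fun _ e => e)
  have hp : m + Finsupp.single i 1 ∈ p.support := by
    rw [mem_support_iff] at hm ⊢
    intro h0
    exact hm (by rw [coeff_pderiv, h0, zero_mul])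
  have hle := le_totalDegree hp
  rw [Finsupp.sum_add_index' (fun _ => rfl) (fun _ _ _ => rfl), Finsupp.sum_single_index rfl]
    at hle
  have : (pderiv i p).totalDegree = m.sum fun _ e => e := hdeg
  omega

theorem eq_C_of_pderiv_eq_zero [CharZero K] {p : MvPolynomial σ K} (h : ∀ i, pderiv i p = 0) :
    p = C (coeff 0 p) := by
  classical
  ext m
  rw [coeff_C]
  split_ifs with hm
  · rw [hm]
  · obtain ⟨i, hi⟩ := Finsupp.ne_iff.mp (Ne.symm hm)
    have hi' : m i ≠ 0 := hi
    have hsub : m - Finsupp.single i 1 + Finsupp.single i 1 = m := by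
      refine tsub_add_cancel_of_le ?_
      rw [Finsupp.single_le_iff]
      omega
    have hc := congrArg (coeff (m - Finsupp.single i 1)) (h i)
    rw [coeff_pderiv, hsub, coeff_zero] at hc
    exact (mul_eq_zero.mp hc).resolve_right (by exact Nat.cast_add_one_ne_zero _)

end Derivatives

section Vacuum

variable {K : Type*} [Field K] {σ : Type*} {A : Type*} [Ring A] [Algebra K A]
  {N : Type*} [AddCommGroup N] [Module A N]

/-- If the `a i` act on polynomials in the `b j` as nonzero multiples of the partial derivatives
and kill `δ`, then `δ` is recovered from `p(b) δ` for each nonzero polynomial `p`: differentiate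
until a nonzero constant is left. -/
theorem mem_of_commEval_smul_mem [CharZero K] [DecidableEq σ] {a b : σ → A} {ε : σ → K}
    (hε : ∀ i, ε i ≠ 0) (hb : ∀ i j, b i * b j = b j * b i)
    (hab : ∀ i j, a i * b j = b j * a i + if i = j then algebraMap K A (ε i) else 0)
    {δ : N} (hδ : ∀ i, a i • δ = 0) (W : Submodule A N) {p : MvPolynomial σ K} (hp : p ≠ 0)
    (hW : commEval b hb p • δ ∈ W) : δ ∈ W := by
  induction hd : p.totalDegree using Nat.strong_induction_on generalizing p with
  | _ d ih =>
    by_cases hconst : ∀ i, pderiv i p = 0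
    · have hpC := eq_C_of_pderiv_eq_zero hconst
      have hc : coeff 0 p ≠ 0 := by
        intro h0
        rw [h0, C_0] at hpC
        exact hp hpC
      rw [hpC, commEval_C] at hW
      have := W.smul_mem (algebraMap K A (coeff 0 p)⁻¹) hW
      rwa [smul_smul, ← map_mul, inv_mul_cancel₀ hc, map_one, one_smul] at this
    · push Not at hconst
      obtain ⟨i, hi⟩ := hconst
      refine ih _ (hd ▸ totalDegree_pderiv_lt hi) hi ?_ rfl
      have h1 := W.smul_mem (algebraMap K A (ε i)⁻¹) (W.smul_mem (a i) hW)
      rwa [smul_smul (a i), mul_commEval hb (hab i), add_smul, mul_smul _ (a i), hδ, smul_zero,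
        zero_add, smul_smul, ← mul_assoc, ← map_mul, inv_mul_cancel₀ (hε i), map_one,
        one_mul] at h1

end Vacuum

end MvPolynomial

/-! ### Generators of the Weyl algebra -/

namespace WeylAlgebra

open MvPolynomial

variable {K : Type*} [Field K] {n : ℕ}

theorem x_mul_x (i j : Fin n) : x K n i * x K n j = x K n j * x K n i := by
  have := RingQuot.mkAlgHom_rel K (Rel.x_comm (K := K) i j)
  rw [map_mul, map_mul] at this
  exact this

theorem d_mul_d (i j : Fin n) : d K n i * d K n j = d K n j * d K n i := by
  have := RingQuot.mkAlgHom_rel K (Rel.d_comm (K := K) i j)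
  rw [map_mul, map_mul] at this
  exact this

theorem d_mul_x (i j : Fin n) :
    d K n i * x K n j = x K n j * d K n i + if i = j then 1 else 0 := by
  have := RingQuot.mkAlgHom_rel K (Rel.d_x (K := K) i j)
  rw [map_mul, map_add, map_mul, apply_ite (RingQuot.mkAlgHom K (Rel K n)), map_one,
    map_zero] at this
  exact this

/-- The inclusion of the polynomial ring into the Weyl algebra. -/
noncomputable def ofPoly : MvPolynomial (Fin n) K →ₐ[K] WeylAlgebra K n :=
  commEval (x K n) x_mul_x

@[simp]
theorem ofPoly_X (i : Fin n) : ofPoly (X i) = x K n i :=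
  commEval_X _ i

theorem ofPoly_C (c : K) : ofPoly (C c) = algebraMap K (WeylAlgebra K n) c :=
  commEval_C _ c

theorem ofPoly_comm (p q : MvPolynomial (Fin n) K) :
    ofPoly p * ofPoly q = ofPoly q * ofPoly p := by
  rw [← map_mul, mul_comm, map_mul]

theorem d_mul_ofPoly (i : Fin n) (p : MvPolynomial (Fin n) K) :
    d K n i * ofPoly p = ofPoly p * d K n i + ofPoly (pderiv i p) := by
  have := mul_commEval x_mul_x (a := d K n i) (i := i) (ε := (1 : K))
    (by simpa using d_mul_x i) p
  rwa [map_one, one_mul] at this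

section Module

variable {N : Type*} [AddCommGroup N] [Module (WeylAlgebra K n) N]

theorem ofPoly_smul_comm (p q : MvPolynomial (Fin n) K) (m : N) :
    ofPoly p • ofPoly q • m = ofPoly q • ofPoly p • m := by
  rw [smul_smul, smul_smul, ofPoly_comm]

theorem d_smul_ofPoly_smul (i : Fin n) (p : MvPolynomial (Fin n) K) (m : N) :
    d K n i • ofPoly p • m = ofPoly p • d K n i • m + ofPoly (pderiv i p) • m := by
  rw [smul_smul, d_mul_ofPoly, add_smul, smul_smul]

/-- An additive submonoid closed under polynomials and derivations is closed under the Weyl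
algebra. -/
theorem smul_mem_of_generators (T : AddSubmonoid N)
    (hp : ∀ (p : MvPolynomial (Fin n) K), ∀ m ∈ T, ofPoly p • m ∈ T)
    (hd : ∀ i, ∀ m ∈ T, d K n i • m ∈ T) (P : WeylAlgebra K n) {m : N} (hm : m ∈ T) :
    P • m ∈ T := by
  obtain ⟨a, rfl⟩ := mk_surjective K n P
  induction a using FreeAlgebra.induction generalizing m with
  | grade0 c =>
    have := hp (C c) m hm
    rw [ofPoly_C] at this
    rwa [AlgHom.commutes]
  | grade1 s =>
    rcases s with i | i
    · have := hp (X i) m hm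
      rwa [ofPoly_X] at this
    · exact hd i m hm
  | mul a b ha hb =>
    rw [map_mul, mul_smul]
    exact ha (hb hm)
  | add a b ha hb =>
    rw [map_add, add_smul]
    exact T.add_mem (ha hm) (hb hm)

/-- The submodule of elements that a power of `f` carries into `W`. -/
def saturation (W : Submodule (WeylAlgebra K n) N) (f : MvPolynomial (Fin n) K) :
    Submodule (WeylAlgebra K n) N :=
  let T : AddSubmonoid N :=
    { carrier := {m | ∃ k : ℕ, ofPoly (f ^ k) • m ∈ W}
      zero_mem' := ⟨0, by simp⟩
      add_mem' := by
        rintro m m' ⟨k, hk⟩ ⟨l, hl⟩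
        refine ⟨k + l, ?_⟩
        rw [smul_add]
        refine W.add_mem ?_ ?_
        · rw [add_comm, pow_add, map_mul, mul_smul]
          exact W.smul_mem _ hk
        · rw [pow_add, map_mul, mul_smul]
          exact W.smul_mem _ hl }
  { T with
    smul_mem' := fun P m hm => smul_mem_of_generators T
      (by
        rintro p m ⟨k, hk⟩
        exact ⟨k, by rw [ofPoly_smul_comm]; exact W.smul_mem _ hk⟩)
      (by
        rintro i m ⟨k, hk⟩
        refine ⟨k + 1, ?_⟩
        have h1 := d_smul_ofPoly_smul i (f ^ (k + 1)) m
        have h2 := eq_sub_of_add_eq h1.symm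
        rw [h2]
        refine W.sub_mem (W.smul_mem _ ?_) ?_
        · rw [pow_succ', map_mul, mul_smul]
          exact W.smul_mem _ hk
        · rw [Derivation.leibniz_pow, Nat.add_sub_cancel, smul_eq_mul, mul_comm, ← smul_mul_assoc,
            map_mul, mul_smul]
          exact W.smul_mem _ hk)
      P hm }

theorem le_saturation (W : Submodule (WeylAlgebra K n) N) (f : MvPolynomial (Fin n) K) :
    W ≤ saturation W f :=
  fun m hm => ⟨0, by simpa using hm⟩

/-- Let `h` act bijectively on `N`. If all `h⁻ᵏ δ` lie in the submodule `W`, then so do all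
`h⁻ᵏ m` with `m` in the submodule generated by `δ`. -/
theorem mem_of_pow_smul_mem_span {h : MvPolynomial (Fin n) K}
    (hbij : Function.Bijective fun m : N => ofPoly h • m) {W : Submodule (WeylAlgebra K n) N}
    {δ : N} (hδ : ∀ (k : ℕ) (u : N), ofPoly (h ^ k) • u = δ → u ∈ W)
    (k : ℕ) (u : N) (hu : ofPoly (h ^ k) • u ∈ Submodule.span (WeylAlgebra K n) {δ}) :
    u ∈ W := by
  have hpow : ∀ k : ℕ, Function.Bijective fun m : N => ofPoly (h ^ k) • m := by
    intro k
    have : (fun m : N => ofPoly (h ^ k) • m) = (fun m : N => ofPoly h • m)^[k] := by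
      funext m
      rw [smul_iterate, map_pow]
    rw [this]
    exact hbij.iterate k
  let T : AddSubmonoid N :=
    { carrier := {m | ∀ (k : ℕ) (u : N), ofPoly (h ^ k) • u = m → u ∈ W}
      zero_mem' := by
        intro k u hu
        have : u = 0 := (hpow k).1 (by simpa using hu)
        rw [this]
        exact W.zero_mem
      add_mem' := by
        intro m m' hm hm' k u hu
        obtain ⟨v, hv⟩ := (hpow k).2 m
        obtain ⟨v', hv'⟩ := (hpow k).2 m'
        have : u = v + v' := (hpow k).1 (by
          simp only [smul_add] at hv hv' ⊢
          rw [hu, hv, hv'])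
        rw [this]
        exact W.add_mem (hm k v hv) (hm' k v' hv') }
  obtain ⟨P, hP⟩ := Submodule.mem_span_singleton.mp hu
  have hT : P • δ ∈ T := by
    refine smul_mem_of_generators T ?_ ?_ P hδ
    · intro p m hm k u hu
      obtain ⟨v, hv⟩ := (hpow k).2 m
      have : u = ofPoly p • v := (hpow k).1 (by
        simp only at hv ⊢
        rw [hu, ofPoly_smul_comm, hv])
      rw [this]
      exact W.smul_mem _ (hm k v hv)
    · intro i m hm k u hu
      obtain ⟨v, hv⟩ := (hpow (k + 1)).2 m
      -- The quotient rule for `∂ᵢ (h⁻ᵏ m)`.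
      have : u = ofPoly h • d K n i • v + ofPoly ((k + 1 : ℕ) • pderiv i h) • v :=
        (hpow k).1 (by
          simp only at hv ⊢
          rw [hu, ← hv, d_smul_ofPoly_smul, smul_add, Derivation.leibniz_pow, Nat.add_sub_cancel,
            smul_eq_mul, ← mul_smul_comm, map_mul ofPoly, pow_succ, map_mul ofPoly, mul_smul,
            mul_smul])
      rw [this]
      have hv' := hm (k + 1) v hv
      exact W.add_mem (W.smul_mem _ (W.smul_mem _ hv')) (W.smul_mem _ hv')
  exact hT k u hP.symm

end Module

end WeylAlgebra

/-! ### Affine coordinate systems -/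

open MvPolynomial

/-- An affine coordinate system `yᵢ = ∑ⱼ Aᵢⱼ xⱼ + cᵢ` on `Kⁿ`, together with the dual basis
`Bᵢ` of constant vector fields. -/
structure AffineFrame (K : Type*) [Field K] (n : ℕ) where
  /-- The linear parts of the coordinate functions. -/
  A : Fin n → Fin n → K
  /-- The dual vector fields. -/
  B : Fin n → Fin n → K
  /-- The constant terms of the coordinate functions. -/
  c : Fin n → K
  dual : ∀ i k, ∑ j, A i j * B k j = if i = k then 1 else 0

namespace AffineFrame

variable {K : Type*} [Field K] {n : ℕ}

/-- The standard coordinates `x₁, …, xₙ`. -/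
def standard (K : Type*) [Field K] (n : ℕ) : AffineFrame K n where
  A i j := if i = j then 1 else 0
  B i j := if i = j then 1 else 0
  c _ := 0
  dual i k := by simp

variable (F : AffineFrame K n) (S : Finset (Fin n))

theorem dual' (j l : Fin n) : ∑ i, F.B i j * F.A i l = if j = l then 1 else 0 := by
  have h : Matrix.of F.A * (Matrix.of F.B).transpose = 1 := by
    ext i k
    simp [Matrix.mul_apply, F.dual, Matrix.one_apply]
  have h' := congrArg (fun M : Matrix (Fin n) (Fin n) K => M j l) (mul_eq_one_comm.mp h)
  simpa [Matrix.mul_apply, Matrix.one_apply] using h'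

/-- The coordinate function `yᵢ`. -/
noncomputable def coord (i : Fin n) : MvPolynomial (Fin n) K :=
  ∑ j, C (F.A i j) * X j + C (F.c i)

/-- The vector field dual to the coordinates, as an element of the Weyl algebra. -/
noncomputable def vec (i : Fin n) : WeylAlgebra K n :=
  ∑ j, algebraMap K _ (F.B i j) * WeylAlgebra.d K n j

/-- The vector field dual to the coordinates, as a derivation of the polynomial ring. -/
noncomputable def deriv (i : Fin n) :
    Derivation K (MvPolynomial (Fin n) K) (MvPolynomial (Fin n) K) :=
  ∑ j, F.B i j • pderiv j

theorem deriv_apply (i : Fin n) (p : MvPolynomial (Fin n) K) :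
    F.deriv i p = ∑ j, C (F.B i j) * pderiv j p := by
  rw [deriv, ← Derivation.coeFnAddMonoidHom_apply, map_sum, Finset.sum_apply]
  simp [MvPolynomial.smul_eq_C_mul]

theorem deriv_coord (i k : Fin n) : F.deriv i (F.coord k) = if i = k then 1 else 0 := by
  have : ∀ j, pderiv j (F.coord k) = C (F.A k j) := by
    intro j
    simp [coord, pderiv_X, Pi.single_apply]
  rw [deriv_apply]
  simp_rw [this, ← C_mul, ← map_sum, mul_comm (F.B i _), F.dual k i, apply_ite C, C_0, C_1,
    eq_comm]

theorem vec_mul_ofPoly (i : Fin n) (p : MvPolynomial (Fin n) K) :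
    F.vec i * WeylAlgebra.ofPoly p =
      WeylAlgebra.ofPoly p * F.vec i + WeylAlgebra.ofPoly (F.deriv i p) := by
  rw [vec, deriv_apply, Finset.sum_mul, Finset.mul_sum, map_sum, ← Finset.sum_add_distrib]
  refine Finset.sum_congr rfl fun j _ => ?_
  rw [map_mul, WeylAlgebra.ofPoly_C, mul_assoc, WeylAlgebra.d_mul_ofPoly, mul_add,
    ← mul_assoc, ← mul_assoc, Algebra.commutes]

theorem vec_mul_vec (i k : Fin n) : F.vec i * F.vec k = F.vec k * F.vec i := by
  simp only [vec, Finset.sum_mul, Finset.mul_sum]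
  rw [Finset.sum_comm]
  refine Finset.sum_congr rfl fun j _ => Finset.sum_congr rfl fun l _ => ?_
  rw [← Algebra.smul_def, ← Algebra.smul_def, smul_mul_smul_comm, smul_mul_smul_comm,
    WeylAlgebra.d_mul_d, mul_comm (F.B _ _)]

theorem X_eq (l : Fin n) : (X l : MvPolynomial (Fin n) K) =
    ∑ i, C (F.B i l) * F.coord i + C (-∑ i, F.B i l * F.c i) := by
  have : ∑ i, C (F.B i l) * F.coord i =
      ∑ j, C (∑ i, F.B i l * F.A i j) * X j + C (∑ i, F.B i l * F.c i) := by
    simp only [coord, mul_add, Finset.sum_add_distrib, Finset.mul_sum, map_sum, Finset.sum_mul,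
      C_mul, mul_assoc]
    rw [Finset.sum_comm]
  rw [this, C_neg, add_neg_cancel_right]
  simp [F.dual']

theorem d_eq (l : Fin n) :
    WeylAlgebra.d K n l = ∑ i, algebraMap K _ (F.A i l) * F.vec i := by
  have : ∑ i, algebraMap K _ (F.A i l) * F.vec i =
      ∑ j, algebraMap K _ (∑ i, F.B i j * F.A i l) * WeylAlgebra.d K n j := by
    simp only [vec, Finset.mul_sum, map_sum, Finset.sum_mul, map_mul]
    rw [Finset.sum_comm]
    refine Finset.sum_congr rfl fun j _ => Finset.sum_congr rfl fun i _ => ?_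
    rw [← mul_assoc, Algebra.commutes]
  rw [this]
  simp [F.dual']

/-- Every polynomial of degree at most one is an affine combination of the coordinates. -/
theorem exists_eq_of_totalDegree_le_one {h : MvPolynomial (Fin n) K} (hh : h.totalDegree ≤ 1) :
    ∃ (α : Fin n → K) (t : K), h = ∑ i, C (α i) * F.coord i + C t := by
  have hX : ∃ (a : Fin n → K) (t : K), h = ∑ l, C (a l) * X l + C t := by
    refine ⟨fun l => coeff (Finsupp.single l 1) h, coeff 0 h, ?_⟩
    classical
    ext m
    have key : ∀ l, coeff m (C (coeff (Finsupp.single l 1) h) * (X l : MvPolynomial (Fin n) K)) =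
        if Finsupp.single l 1 = m then coeff (Finsupp.single l 1) h else 0 := by
      intro l
      rw [coeff_C_mul, coeff_X, mul_ite, mul_one, mul_zero]
    rw [coeff_add, coeff_sum, Finset.sum_congr rfl fun l _ => key l, coeff_C]
    by_cases hm : 1 < m.degree
    · rw [coeff_eq_zero_of_totalDegree_lt (by
        refine lt_of_le_of_lt hh ?_
        rwa [Finsupp.degree_eq_sum, ← Finsupp.sum_fintype m (fun _ e => e) (by simp)] at hm)]
      rw [Finset.sum_eq_zero, if_neg, add_zero]
      · rintro rfl
        simp at hm
      · intro l _
        rw [if_neg]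
        rintro rfl
        simp at hm
    · have : m.degree = 0 ∨ m.degree = 1 := by omega
      rcases this with h0 | h1
      · rw [Finsupp.degree_eq_zero_iff] at h0
        subst h0
        simp
      · obtain ⟨l, rfl⟩ : m ∈ Set.range fun l : Fin n => Finsupp.single l 1 :=
          Finsupp.range_single_one ▸ h1
        rw [Finset.sum_eq_single l]
        · simpa using fun h0 : 0 = Finsupp.single l 1 => by simpa using DFunLike.congr_fun h0 l
        · intro b _ hb
          rw [if_neg]
          intro h
          exact hb (Finsupp.single_left_injective one_ne_zero h)
        · simp
  obtain ⟨a, t, rfl⟩ := hX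
  refine ⟨fun i => ∑ l, a l * F.B i l, ∑ l, a l * (-∑ i, F.B i l * F.c i) + t, ?_⟩
  rw [C_add, ← add_assoc]
  congr 1
  simp only [map_sum, Finset.sum_mul, C_mul]
  rw [Finset.sum_comm, ← Finset.sum_add_distrib]
  refine Finset.sum_congr rfl fun l _ => ?_
  conv_lhs => rw [F.X_eq l]
  rw [mul_add, Finset.mul_sum]
  simp only [mul_assoc]

/-- A function `∑ αᵢ yᵢ + t` with `αⱼ ≠ 0` can replace the coordinate `yⱼ`. -/
theorem exists_replace {j : Fin n} {α : Fin n → K} (hα : α j ≠ 0) (t : K) :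
    ∃ F' : AffineFrame K n, F'.coord j = ∑ i, C (α i) * F.coord i + C t ∧
      (∀ i ≠ j, F'.coord i = F.coord i) ∧
      ∀ i ≠ j, F'.vec i = F.vec i - algebraMap K _ (α i / α j) * F.vec j := by
  refine ⟨⟨fun i => if i = j then fun l => ∑ k, α k * F.A k l else F.A i,
    fun i l => if i = j then (α j)⁻¹ * F.B j l else F.B i l - α i / α j * F.B j l,
    fun i => if i = j then ∑ k, α k * F.c k + t else F.c i, ?_⟩, ?_, ?_, ?_⟩
  · have hsum : ∀ k, ∑ l, (∑ i, α i * F.A i l) * F.B k l = α k := by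
      intro k
      simp only [Finset.sum_mul]
      rw [Finset.sum_comm]
      simp only [mul_assoc, ← Finset.mul_sum, F.dual]
      simp
    intro i k
    by_cases hk : k = j
    · subst hk
      simp only [if_true, mul_left_comm _ (α k)⁻¹, ← Finset.mul_sum]
      by_cases hi : i = k
      · subst hi
        simp only [if_true, hsum]
        exact inv_mul_cancel₀ hα
      · simp only [if_neg hi, F.dual, mul_zero]
    · simp only [if_neg hk, mul_sub, Finset.sum_sub_distrib, mul_left_comm _ (α k / α j),
        ← Finset.mul_sum]
      by_cases hi : i = j
      · subst hi
        simp only [if_true, hsum, if_neg (Ne.symm hk)]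
        rw [div_mul_cancel₀ _ hα, sub_self]
      · simp only [if_neg hi, F.dual, mul_zero, sub_zero]
  · simp only [coord, if_true, mul_add, Finset.sum_add_distrib, Finset.mul_sum, map_sum,
      Finset.sum_mul, C_mul, C_add, mul_assoc, add_assoc]
    rw [Finset.sum_comm]
  · intro i hi
    simp [coord, hi]
  · intro i hi
    simp only [vec, if_neg hi, map_sub, map_mul, sub_mul, Finset.sum_sub_distrib, Finset.mul_sum,
      mul_assoc]

/-- The flat on which the coordinates `yᵢ`, `i ∈ S`, vanish. -/
def flat : Set (Fin n → K) := {v | ∀ i ∈ S, eval v (F.coord i) = 0}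

theorem eval_coord (v : Fin n → K) (i : Fin n) :
    eval v (F.coord i) = ∑ j, F.A i j * v j + F.c i := by
  simp [coord]

/-- The point with prescribed coordinates. -/
def point (t : Fin n → K) : Fin n → K := fun l => ∑ i, F.B i l * (t i - F.c i)

@[simp]
theorem eval_point_coord (t : Fin n → K) (i : Fin n) : eval (F.point t) (F.coord i) = t i := by
  rw [eval_coord]
  simp only [point, Finset.mul_sum]
  rw [Finset.sum_comm]
  simp only [← mul_assoc, ← Finset.sum_mul, F.dual]
  simp

@[simp]
theorem point_eval_coord (v : Fin n → K) : F.point (fun i => eval v (F.coord i)) = v := by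
  funext l
  simp only [point, eval_coord, add_sub_cancel_right, Finset.mul_sum]
  rw [Finset.sum_comm]
  simp only [← mul_assoc, ← Finset.sum_mul, F.dual']
  simp

theorem flat_nonempty : (F.flat S).Nonempty :=
  ⟨F.point 0, fun i _ => by simp⟩

theorem finrank_quotient_vectorSpan_flat :
    Module.finrank K ((Fin n → K) ⧸ vectorSpan K (F.flat S)) = S.card := by
  let φ : (Fin n → K) →ₗ[K] (S → K) :=
    LinearMap.pi fun i => ∑ j, F.A i j • LinearMap.proj j
  have hφ : ∀ v i, φ v i = eval v (F.coord i) - F.c i := by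
    intro v i
    simp [φ, eval_coord]
  have hsurj : Function.Surjective φ := by
    intro t
    refine ⟨F.point fun i => (if hi : i ∈ S then t ⟨i, hi⟩ else 0) + F.c i, ?_⟩
    funext i
    rw [hφ, eval_point_coord]
    simp
  have hker : vectorSpan K (F.flat S) = LinearMap.ker φ := by
    have h0 : F.point 0 ∈ F.flat S := fun i _ => by simp
    rw [vectorSpan_eq_span_vsub_set_right K h0]
    have : (fun p => p -ᵥ F.point 0) '' F.flat S = (LinearMap.ker φ : Set (Fin n → K)) := by
      ext v
      simp only [Set.mem_image, SetLike.mem_coe, LinearMap.mem_ker]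
      constructor
      · rintro ⟨p, hp, rfl⟩
        rw [vsub_eq_sub, map_sub, sub_eq_zero]
        funext i
        rw [hφ, hφ, hp i i.2, h0 i i.2]
      · intro hv
        refine ⟨v + F.point 0, fun i hi => ?_, by simp⟩
        have h1 := hφ (v + F.point 0) ⟨i, hi⟩
        rw [map_add, hv, zero_add, hφ] at h1
        have h2 := h0 i hi
        simp only at h1
        rw [← sub_left_inj (a := F.c i), ← h1, h2]
    rw [this, Submodule.span_eq]
  rw [hker, (φ.quotKerEquivOfSurjective hsurj).finrank_eq]
  simp

/-- Restriction of polynomials to the flat of `S`, written in the coordinates `yᵢ`, `i ∉ S`. -/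
noncomputable def restrict : MvPolynomial (Fin n) K →ₐ[K] MvPolynomial (Fin n) K :=
  aeval fun l => ∑ i, C (F.B i l) * (if i ∈ S then 0 else X i) + C (-∑ i, F.B i l * F.c i)

theorem eval_restrict (t : Fin n → K) (q : MvPolynomial (Fin n) K) :
    eval t (F.restrict S q) = eval (F.point fun i => if i ∈ S then 0 else t i) q := by
  induction q using MvPolynomial.induction_on with
  | C c => simp [restrict]
  | add p q hp hq => simp [hp, hq]
  | mul_X p l hp =>
    rw [map_mul, map_mul, hp, map_mul]
    congr 1
    simp only [restrict, aeval_X, eval_X, point, mul_sub, Finset.sum_sub_distrib, map_add, map_sum,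
      map_mul, eval_C, apply_ite (eval t), map_zero, map_neg]
    rw [sub_eq_add_neg]

theorem eval_restrict_of_mem {v : Fin n → K} (hv : v ∈ F.flat S) (q : MvPolynomial (Fin n) K) :
    eval (fun i => eval v (F.coord i)) (F.restrict S q) = eval v q := by
  rw [eval_restrict]
  conv_rhs => rw [← F.point_eval_coord v]
  congr 3
  funext i
  split_ifs with hi
  · exact (hv i hi).symm
  · rfl

/-- The kernel of the restriction map is the vanishing ideal of the flat. -/
theorem restrict_eq_zero_iff [Infinite K] {q : MvPolynomial (Fin n) K} :
    F.restrict S q = 0 ↔ ∀ v ∈ F.flat S, eval v q = 0 := by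
  constructor
  · intro h v hv
    rw [← F.eval_restrict_of_mem S hv, h, map_zero]
  · intro h
    refine MvPolynomial.funext fun t => ?_
    rw [eval_restrict, map_zero]
    exact h _ fun i hi => by simp [hi]

/-! ### Vacuum vectors -/

/-- The operators `yᵢ` (`i ∈ S`) and `wᵢ` (`i ∉ S`) that annihilate the delta function of the flat
of `S`. -/
noncomputable def lower (i : Fin n) : WeylAlgebra K n :=
  if i ∈ S then WeylAlgebra.ofPoly (F.coord i) else F.vec i

/-- The operators `wᵢ` (`i ∈ S`) and `yᵢ` (`i ∉ S`) complementary to `AffineFrame.lower`. -/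
noncomputable def raise (i : Fin n) : WeylAlgebra K n :=
  if i ∈ S then F.vec i else WeylAlgebra.ofPoly (F.coord i)

theorem raise_mul_raise (i j : Fin n) :
    F.raise S i * F.raise S j = F.raise S j * F.raise S i := by
  unfold raise
  split_ifs with hi hj hj
  · exact F.vec_mul_vec i j
  · have : i ≠ j := fun h => hj (h ▸ hi)
    rw [vec_mul_ofPoly, deriv_coord, if_neg this, map_zero, add_zero]
  · have : j ≠ i := fun h => hi (h ▸ hj)
    rw [vec_mul_ofPoly, deriv_coord, if_neg this, map_zero, add_zero]
  · exact WeylAlgebra.ofPoly_comm _ _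

theorem lower_mul_raise (i j : Fin n) :
    F.lower S i * F.raise S j = F.raise S j * F.lower S i +
      if i = j then algebraMap K _ (if i ∈ S then -1 else 1) else 0 := by
  unfold raise lower
  split_ifs with hi hj hij hij hj hij hij
  · rw [vec_mul_ofPoly, deriv_coord, if_pos hij.symm]
    simp
  · rw [vec_mul_ofPoly, deriv_coord, if_neg (Ne.symm hij)]
    simp
  · exact absurd (hij ▸ hi) hj
  · rw [WeylAlgebra.ofPoly_comm, add_zero]
  · exact absurd (hij ▸ hj) hi
  · rw [vec_mul_vec, add_zero]
  · rw [vec_mul_ofPoly, deriv_coord, if_pos hij]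
    simp
  · rw [vec_mul_ofPoly, deriv_coord, if_neg hij]
    simp

/-- Polynomials in the raising operators. -/
noncomputable def fock : MvPolynomial (Fin n) K →ₐ[K] WeylAlgebra K n :=
  commEval (F.raise S) (F.raise_mul_raise S)

theorem fock_X (i : Fin n) : F.fock S (X i) = F.raise S i :=
  commEval_X _ i

theorem fock_C (c : K) : F.fock S (C c) = algebraMap K _ c :=
  commEval_C _ c

section Module

variable {N : Type*} [AddCommGroup N] [Module (WeylAlgebra K n) N]

/-- An element with the annihilators of the delta function of the flat of `S`: it is killed by the
functions vanishing on the flat and by the vector fields along it. -/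
def IsVacuum (δ : N) : Prop := ∀ i, F.lower S i • δ = 0

variable {F S} {δ : N}

theorem IsVacuum.coord_smul (hδ : F.IsVacuum S δ) {i : Fin n} (hi : i ∈ S) :
    WeylAlgebra.ofPoly (F.coord i) • δ = 0 := by
  have := hδ i
  rwa [lower, if_pos hi] at this

theorem IsVacuum.vec_smul (hδ : F.IsVacuum S δ) {i : Fin n} (hi : i ∉ S) :
    F.vec i • δ = 0 := by
  have := hδ i
  rwa [lower, if_neg hi] at this

theorem isVacuum_iff : F.IsVacuum S δ ↔
    (∀ i ∈ S, WeylAlgebra.ofPoly (F.coord i) • δ = 0) ∧ ∀ i ∉ S, F.vec i • δ = 0 := by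
  refine ⟨fun h => ⟨fun i => h.coord_smul, fun i => h.vec_smul⟩, fun h i => ?_⟩
  unfold lower
  split_ifs with hi
  · exact h.1 i hi
  · exact h.2 i hi

theorem IsVacuum.mem_of_fock_smul_mem [CharZero K] (hδ : F.IsVacuum S δ)
    (W : Submodule (WeylAlgebra K n) N) {p : MvPolynomial (Fin n) K} (hp : p ≠ 0)
    (hW : F.fock S p • δ ∈ W) : δ ∈ W :=
  mem_of_commEval_smul_mem (ε := fun i => if i ∈ S then -1 else 1)
    (fun i => by split_ifs <;> simp) (F.raise_mul_raise S) (F.lower_mul_raise S) hδ W hp hW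

theorem IsVacuum.fock_smul_injective [CharZero K] (hδ : F.IsVacuum S δ) (h0 : δ ≠ 0)
    {p q : MvPolynomial (Fin n) K} (h : F.fock S p • δ = F.fock S q • δ) : p = q := by
  by_contra hpq
  refine h0 ((Submodule.mem_bot (WeylAlgebra K n)).mp
    (hδ.mem_of_fock_smul_mem ⊥ (sub_ne_zero.mpr hpq) ?_))
  rw [map_sub, sub_smul, h, sub_self]
  exact Submodule.zero_mem _

/-- On a vacuum vector, a function acts through its restriction to the flat. -/
theorem IsVacuum.ofPoly_smul (hδ : F.IsVacuum S δ) (q : MvPolynomial (Fin n) K) :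
    WeylAlgebra.ofPoly q • δ = F.fock S (F.restrict S q) • δ := by
  induction q using MvPolynomial.induction_on with
  | C c =>
    have hc : F.restrict S (C c) = C c := (F.restrict S).commutes c
    rw [hc, fock_C, WeylAlgebra.ofPoly_C]
  | add p q hp hq => rw [map_add, add_smul, hp, hq, map_add, map_add, add_smul]
  | mul_X p l hp =>
    -- The part of `xₗ` that does not kill `δ`. Acting on `δ` first lets it commute past the rest.
    let τ : MvPolynomial (Fin n) K :=
      ∑ i, C (F.B i l) * (if i ∈ S then 0 else F.coord i) + C (-∑ i, F.B i l * F.c i)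
    have hτ : F.fock S (F.restrict S (X l)) = WeylAlgebra.ofPoly τ := by
      simp only [restrict, aeval_X, τ, map_add, map_sum, map_mul]
      congr 1
      · refine Finset.sum_congr rfl fun i _ => ?_
        congr 1
        · rw [fock_C, WeylAlgebra.ofPoly_C]
        · split_ifs with hi
          · simp
          · rw [fock_X, raise, if_neg hi]
      · rw [fock_C, WeylAlgebra.ofPoly_C]
    have hX : WeylAlgebra.ofPoly (X l : MvPolynomial (Fin n) K) • δ =
        WeylAlgebra.ofPoly τ • δ := by
      conv_lhs => rw [F.X_eq l]
      simp only [τ, map_add, add_smul, map_sum, Finset.sum_smul, map_mul, mul_smul]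
      congr 1
      refine Finset.sum_congr rfl fun i _ => ?_
      split_ifs with hi
      · rw [hδ.coord_smul hi, map_zero, zero_smul]
      · rfl
    rw [map_mul, mul_smul, hX, smul_smul, WeylAlgebra.ofPoly_comm, mul_smul, hp, map_mul, mul_comm,
      map_mul, mul_smul, hτ]

/-- The submodule generated by a vacuum vector consists of the `p(b) δ`, with `p` a polynomial and
`b` the raising operators. -/
theorem IsVacuum.exists_fock_smul_eq (hδ : F.IsVacuum S δ) {m : N}
    (hm : m ∈ Submodule.span (WeylAlgebra K n) {δ}) :
    ∃ p : MvPolynomial (Fin n) K, F.fock S p • δ = m := by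
  let T : AddSubmonoid N :=
    { carrier := {m | ∃ p : MvPolynomial (Fin n) K, F.fock S p • δ = m}
      zero_mem' := ⟨0, by simp⟩
      add_mem' := by
        rintro _ _ ⟨p, rfl⟩ ⟨q, rfl⟩
        exact ⟨p + q, by rw [map_add, add_smul]⟩ }
  have hC : ∀ (c : K), ∀ m ∈ T, algebraMap K (WeylAlgebra K n) c • m ∈ T := by
    rintro c _ ⟨p, rfl⟩
    exact ⟨C c * p, by rw [map_mul, mul_smul, fock_C]⟩
  have hraise : ∀ i, ∀ m ∈ T, F.raise S i • m ∈ T := by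
    rintro i _ ⟨p, rfl⟩
    exact ⟨X i * p, by rw [map_mul, mul_smul, fock_X]⟩
  have hlower : ∀ i, ∀ m ∈ T, F.lower S i • m ∈ T := by
    rintro i _ ⟨p, rfl⟩
    have h1 : F.lower S i • F.fock S p • δ =
        algebraMap K (WeylAlgebra K n) (if i ∈ S then -1 else 1) •
          F.fock S (pderiv i p) • δ := by
      rw [smul_smul, fock, mul_commEval _ (F.lower_mul_raise S i), add_smul,
        mul_smul _ (F.lower S i), hδ i, smul_zero, zero_add, mul_smul]
    rw [h1]
    exact hC _ _ ⟨_, rfl⟩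
  have hcoord : ∀ i, ∀ m ∈ T, WeylAlgebra.ofPoly (F.coord i) • m ∈ T := by
    intro i m hm
    by_cases hi : i ∈ S
    · simpa [lower, hi] using hlower i m hm
    · simpa [raise, hi] using hraise i m hm
  have hvec : ∀ i, ∀ m ∈ T, F.vec i • m ∈ T := by
    intro i m hm
    by_cases hi : i ∈ S
    · simpa [raise, hi] using hraise i m hm
    · simpa [lower, hi] using hlower i m hm
  obtain ⟨P, rfl⟩ := Submodule.mem_span_singleton.mp hm
  refine WeylAlgebra.smul_mem_of_generators T ?_ ?_ P ⟨1, by simp⟩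
  · intro p
    induction p using MvPolynomial.induction_on with
    | C c => intro m hm; rw [WeylAlgebra.ofPoly_C]; exact hC c m hm
    | add p q hp hq =>
      intro m hm
      rw [map_add, add_smul]
      exact T.add_mem (hp m hm) (hq m hm)
    | mul_X p l hp =>
      intro m hm
      rw [map_mul, mul_smul]
      refine hp _ ?_
      rw [F.X_eq l, map_add, map_sum, add_smul, Finset.sum_smul]
      refine T.add_mem (T.sum_mem fun i _ => ?_) ?_
      · rw [map_mul, mul_smul, WeylAlgebra.ofPoly_C]
        exact hC _ _ (hcoord i m hm)
      · rw [WeylAlgebra.ofPoly_C]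
        exact hC _ _ hm
  · intro l m hm
    rw [F.d_eq l, Finset.sum_smul]
    refine T.sum_mem fun i _ => ?_
    rw [mul_smul]
    exact hC _ _ (hvec i m hm)

/-- A nonzero vacuum vector generates a simple module. -/
theorem IsVacuum.isSimpleModule_span [CharZero K] (hδ : F.IsVacuum S δ) (h0 : δ ≠ 0) :
    IsSimpleModule (WeylAlgebra K n) (Submodule.span (WeylAlgebra K n) {δ}) := by
  rw [isSimpleModule_iff_isAtom]
  refine ⟨by simpa using h0, fun W hW => ?_⟩
  by_contra hW0
  obtain ⟨m, hm, hm0⟩ := W.ne_bot_iff.mp hW0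
  obtain ⟨p, rfl⟩ := hδ.exists_fock_smul_eq (hW.le hm)
  have hp : p ≠ 0 := by
    rintro rfl
    simp at hm0
  refine hW.not_ge ?_
  rw [Submodule.span_singleton_le_iff_mem]
  exact hδ.mem_of_fock_smul_mem W hp hm

end Module

end AffineFrame

/-! ### Counting flats with signs -/

section FlatSum

variable {K : Type*} [Field K] {n : ℕ} {ι : Type*}

/-- The zero locus of a polynomial. -/
def zeros (p : MvPolynomial (Fin n) K) : Set (Fin n → K) := {v | eval v p = 0}

open Classical in
/-- The sum of `(-1) ^ (|B| + codim Z)` over the sets `B` of indices from `s` for which the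
intersection `Z` of `X` with the hyperplanes indexed by `B` satisfies `P`. -/
noncomputable def flatSum (h : ι → MvPolynomial (Fin n) K) (P : Set (Fin n → K) → Prop)
    (X : Set (Fin n → K)) (s : Finset ι) : ℤ :=
  ∑ B ∈ s.powerset, if P (X ∩ ⋂ i ∈ B, zeros (h i)) then
    (-1) ^ (B.card + Module.finrank K ((Fin n → K) ⧸
      vectorSpan K (X ∩ ⋂ i ∈ B, zeros (h i)))) else 0

variable (h : ι → MvPolynomial (Fin n) K) (P : Set (Fin n → K) → Prop) (X : Set (Fin n → K))

theorem flatSum_insert [DecidableEq ι] {s : Finset ι} {j : ι} (hj : j ∉ s) :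
    flatSum h P X (insert j s) = flatSum h P X s - flatSum h P (X ∩ zeros (h j)) s := by
  rw [flatSum, Finset.sum_powerset_insert hj, sub_eq_add_neg, flatSum, flatSum,
    ← Finset.sum_neg_distrib]
  congr 1
  refine Finset.sum_congr rfl fun B hB => ?_
  have hjB : j ∉ B := fun h => hj (Finset.mem_powerset.mp hB h)
  rw [Finset.set_biInter_insert, ← Set.inter_assoc, Finset.card_insert_of_notMem hjB]
  split_ifs
  · ring
  · simp

theorem flatSum_empty_set {P : Set (Fin n → K) → Prop} (hP : ¬ P ∅) (s : Finset ι) :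
    flatSum h P ∅ s = 0 := by
  simp [flatSum, hP]

theorem flatSum_empty [Decidable (P X)] : flatSum h P X ∅ =
    if P X then (-1) ^ Module.finrank K ((Fin n → K) ⧸ vectorSpan K X) else 0 := by
  have hX : X ∩ ⋂ i ∈ (∅ : Finset ι), zeros (h i) = X := by simp
  rw [flatSum, Finset.powerset_empty, Finset.sum_singleton, hX, Finset.card_empty, zero_add]
  congr

end FlatSum

namespace AffineFrame

variable {K : Type*} [Field K] {n : ℕ} {ι : Type*}

/-- The position of a flat with respect to a hyperplane: it lies inside it, or misses it, or meets
it transversally. -/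
theorem flat_trichotomy (F : AffineFrame K n) (S : Finset (Fin n)) {α : Fin n → K} {t : K}
    {h : MvPolynomial (Fin n) K} (hh : h = ∑ i, C (α i) * F.coord i + C t) :
    ((∀ i ∉ S, α i = 0) ∧ t = 0 ∧ F.flat S ∩ zeros h = F.flat S) ∨
    ((∀ i ∉ S, α i = 0) ∧ t ≠ 0 ∧ F.flat S ∩ zeros h = ∅) ∨
    ∃ j ∉ S, α j ≠ 0 ∧ ¬ F.flat S ⊆ zeros h ∧ ∃ F' : AffineFrame K n, F'.coord j = h ∧
      (∀ i ≠ j, F'.coord i = F.coord i) ∧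
      (∀ i ≠ j, F'.vec i = F.vec i - algebraMap K _ (α i / α j) * F.vec j) ∧
      F'.flat (insert j S) = F.flat S ∩ zeros h := by
  have heval : ∀ v, eval v h = ∑ i, α i * eval v (F.coord i) + t := by
    intro v
    simp [hh]
  by_cases hα : ∀ i ∉ S, α i = 0
  · have hv : ∀ v ∈ F.flat S, eval v h = t := by
      intro v hv
      rw [heval, Finset.sum_eq_zero, zero_add]
      intro i _
      by_cases hi : i ∈ S
      · rw [hv i hi, mul_zero]
      · rw [hα i hi, zero_mul]
    by_cases ht : t = 0
    · exact Or.inl ⟨hα, ht, Set.inter_eq_left.mpr fun v hvS => (hv v hvS).trans ht⟩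
    · refine Or.inr (Or.inl ⟨hα, ht, ?_⟩)
      rw [Set.eq_empty_iff_forall_notMem]
      rintro v ⟨hvS, hv0⟩
      exact ht ((hv v hvS).symm.trans hv0)
  · push Not at hα
    obtain ⟨j, hj, hαj⟩ := hα
    obtain ⟨F', h1, h2, h3⟩ := F.exists_replace hαj t
    refine Or.inr (Or.inr ⟨j, hj, hαj, ?_, F', h1.trans hh.symm, h2, h3, ?_⟩)
    · intro hsub
      -- Compare the values of `h` at two points of the flat that differ in the coordinate `yⱼ`.
      have hpt : ∀ r : K, ∑ i, α i * (Pi.single j r : Fin n → K) i + t = 0 := by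
        intro r
        have : F.point (Pi.single j r) ∈ F.flat S := by
          intro i hi
          rw [eval_point_coord, Pi.single_eq_of_ne]
          rintro rfl
          exact hj hi
        have h0 : eval _ h = 0 := hsub this
        simpa only [heval, eval_point_coord] using h0
      have e0 := hpt 0
      have e1 := hpt 1
      simp [Pi.single_apply] at e0 e1
      rw [e0, add_zero] at e1
      exact hαj e1
    · ext v
      simp only [flat, Set.mem_ofPred_eq, Set.mem_inter_iff, Finset.mem_insert, zeros,
        forall_eq_or_imp]
      rw [h1, ← hh, and_comm]
      refine and_congr_left fun _ => forall₂_congr fun i hi => ?_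
      rw [h2 i]
      rintro rfl
      exact hj hi

/-- The contributions of all flats to the signed count have the same sign. -/
theorem neg_one_pow_card_mul_flatSum_nonneg {h : ι → MvPolynomial (Fin n) K}
    (hdeg : ∀ i, (h i).totalDegree ≤ 1) {P : Set (Fin n → K) → Prop} (hP : ¬ P ∅)
    (s : Finset ι) (F : AffineFrame K n) (S : Finset (Fin n)) :
    0 ≤ (-1) ^ S.card * flatSum h P (F.flat S) s := by
  classical
  induction s using Finset.induction_on generalizing F S with
  | empty =>
    rw [flatSum_empty, finrank_quotient_vectorSpan_flat]
    split_ifs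
    · rw [← mul_pow]
      simp
    · simp
  | insert a s ha ih =>
    obtain ⟨α, t, hh⟩ := F.exists_eq_of_totalDegree_le_one (hdeg a)
    rw [flatSum_insert h P _ ha]
    rcases F.flat_trichotomy S hh with ⟨-, -, he⟩ | ⟨-, -, he⟩ |
      ⟨j, hj, -, -, F', -, -, -, he⟩
    · rw [he, sub_self, mul_zero]
    · rw [he, flatSum_empty_set h hP, sub_zero]
      exact ih F S
    · have h1 := ih F S
      have h2 := ih F' (insert j S)
      rw [← he]
      rw [Finset.card_insert_of_notMem hj, pow_succ] at h2
      linarith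

end AffineFrame

/-! ### Lengths of localized vacuum modules -/

namespace WeylAlgebra

variable {K : Type*} [Field K] {n : ℕ}

section Module

variable {N : Type*} [AddCommGroup N] [Module (WeylAlgebra K n) N]

theorem mem_saturation_of_smul_mem {W : Submodule (WeylAlgebra K n) N}
    {p f : MvPolynomial (Fin n) K} (hpf : p ∣ f) {u : N}
    (hu : ofPoly p • u ∈ saturation W f) : u ∈ saturation W f := by
  obtain ⟨g, rfl⟩ := hpf
  obtain ⟨k, hk⟩ := hu
  refine ⟨k + 1, ?_⟩
  have : (p * g) ^ (k + 1) = g * ((p * g) ^ k * p) := by ring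
  rw [this, map_mul, mul_smul, map_mul, mul_smul]
  exact W.smul_mem _ hk

theorem prod_pow_smul_injective {ι : Type*} {h : ι → MvPolynomial (Fin n) K} {s : Finset ι}
    (hinj : ∀ i ∈ s, Function.Injective fun m : N => ofPoly (h i) • m) (k : ℕ) :
    Function.Injective fun m : N => ofPoly ((∏ i ∈ s, h i) ^ k) • m := by
  classical
  have h1 : Function.Injective fun m : N => ofPoly (∏ i ∈ s, h i) • m := by
    induction s using Finset.induction_on with
    | empty => simp [Function.Injective]
    | insert a s ha ih =>
      intro m m' hm
      simp only [Finset.prod_insert ha, map_mul ofPoly, mul_smul] at hm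
      exact ih (fun i hi => hinj i (Finset.mem_insert_of_mem hi))
        (hinj a (Finset.mem_insert_self a s) hm)
  induction k with
  | zero => simp [Function.Injective]
  | succ k ih =>
    intro m m' hm
    simp only [pow_succ, map_mul ofPoly, mul_smul] at hm
    exact h1 (ih hm)

end Module

end WeylAlgebra

open WeylAlgebra

/-- `N` looks like the localization, at the product of the `h i` with `i ∈ s`, of the module
generated by the delta function `δ` of the flat of `S`. If one of these hyperplanes contains the
flat, that localization is zero, and so `δ` is only required to be nonzero in the other case. -/
structure IsLocalizedVacuum {K : Type*} [Field K] {n : ℕ} {ι : Type*} {N : Type*}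
    [AddCommGroup N] [Module (WeylAlgebra K n) N] (F : AffineFrame K n) (S : Finset (Fin n))
    (h : ι → MvPolynomial (Fin n) K) (s : Finset ι) (δ : N) : Prop where
  vacuum : F.IsVacuum S δ
  bijective : ∀ i ∈ s, Function.Bijective fun m : N => ofPoly (h i) • m
  mem_saturation : ∀ m : N,
    m ∈ saturation (Submodule.span (WeylAlgebra K n) {δ}) (∏ i ∈ s, h i)
  ne_zero : (∀ i ∈ s, ¬ F.flat S ⊆ zeros (h i)) → δ ≠ 0

namespace IsLocalizedVacuum

variable {K : Type*} [Field K] {n : ℕ} {ι : Type*} {N : Type*}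
    [AddCommGroup N] [Module (WeylAlgebra K n) N] {F : AffineFrame K n} {S : Finset (Fin n)}
    {h : ι → MvPolynomial (Fin n) K} {s : Finset ι} {δ : N}

theorem length_of_empty [CharZero K] (H : IsLocalizedVacuum F S h ∅ δ) :
    Module.length (WeylAlgebra K n) N = 1 := by
  have htop : Submodule.span (WeylAlgebra K n) {δ} = ⊤ := by
    rw [eq_top_iff]
    intro m _
    obtain ⟨k, hk⟩ := H.mem_saturation m
    simpa using hk
  have hs := H.vacuum.isSimpleModule_span (H.ne_zero (by simp))
  rw [htop] at hs
  rw [← Module.length_top, Module.length_eq_one_iff]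
  exact hs

/-- On a flat along which `h = ∑ αᵢ yᵢ + t` is constant, the vacuum vector is an eigenvector. -/
theorem smul_vacuum_of_const (hδ : F.IsVacuum S δ) {α : Fin n → K} {t : K}
    {p : MvPolynomial (Fin n) K} (hp : p = ∑ i, C (α i) * F.coord i + C t)
    (hα : ∀ i ∉ S, α i = 0) : ofPoly p • δ = algebraMap K (WeylAlgebra K n) t • δ := by
  rw [hp, map_add, add_smul, map_sum, Finset.sum_smul, Finset.sum_eq_zero, zero_add, ofPoly_C]
  intro i _
  by_cases hi : i ∈ S
  · rw [map_mul, mul_smul, hδ.coord_smul hi, smul_zero]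
  · rw [hα i hi, C_0, zero_mul, map_zero, zero_smul]

variable [DecidableEq ι] {a : ι}

theorem subsingleton (H : IsLocalizedVacuum F S h (insert a s) δ) (h0 : ofPoly (h a) • δ = 0) :
    Subsingleton N := by
  have hδ : δ = 0 := (H.bijective a (Finset.mem_insert_self a s)).1 (by simpa using h0)
  refine subsingleton_of_forall_eq 0 fun m => ?_
  obtain ⟨k, hk⟩ := H.mem_saturation m
  rw [hδ, Submodule.span_zero_singleton, Submodule.mem_bot] at hk
  exact prod_pow_smul_injective (fun i hi => (H.bijective i hi).1) k (by simpa using hk)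

/-- If a submodule `W` contains all `(h a)⁻ᵏ δ`, then every element of `N` is carried into `W` by a
power of the product of the other `h i`. -/
theorem mem_saturation_of_forall_mem (ha : a ∉ s)
    (H : IsLocalizedVacuum F S h (insert a s) δ) {W : Submodule (WeylAlgebra K n) N}
    (hW : ∀ (k : ℕ) (u : N), ofPoly (h a ^ k) • u = δ → u ∈ W) (m : N) :
    m ∈ saturation W (∏ i ∈ s, h i) := by
  obtain ⟨k, hk⟩ := H.mem_saturation m
  refine ⟨k, mem_of_pow_smul_mem_span (H.bijective a (Finset.mem_insert_self a s)) hW k _ ?_⟩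
  rwa [smul_smul, ← map_mul, ← mul_pow, ← Finset.prod_insert ha]

/-- A hyperplane that misses the flat may be dropped. -/
theorem of_insert (ha : a ∉ s) (H : IsLocalizedVacuum F S h (insert a s) δ) {t : K} (ht : t ≠ 0)
    (hconst : ofPoly (h a) • δ = algebraMap K (WeylAlgebra K n) t • δ)
    (hsub : ¬ F.flat S ⊆ zeros (h a)) : IsLocalizedVacuum F S h s δ where
  vacuum := H.vacuum
  bijective i hi := H.bijective i (Finset.mem_insert_of_mem hi)
  mem_saturation := by
    have hpow : ∀ (k : ℕ) (u : N), ofPoly (h a ^ k) • u = δ →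
        u = algebraMap K (WeylAlgebra K n) (t⁻¹ ^ k) • δ := by
      intro k
      induction k with
      | zero =>
        intro u hu
        simpa using hu
      | succ k ih =>
        intro u hu
        refine (H.bijective a (Finset.mem_insert_self a s)).1 ?_
        simp only
        rw [ih (ofPoly (h a) • u) (by rwa [pow_succ, map_mul, mul_smul] at hu), ← ofPoly_C,
          ← ofPoly_C, ofPoly_smul_comm, hconst, ← ofPoly_C, smul_smul, ← map_mul, ← C_mul,
          pow_succ, mul_assoc, inv_mul_cancel₀ ht, mul_one]
    refine H.mem_saturation_of_forall_mem ha fun k u hu => ?_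
    rw [hpow k u hu]
    exact Submodule.smul_mem _ _ (Submodule.mem_span_singleton_self δ)
  ne_zero hs := H.ne_zero fun i hi => by
    rcases Finset.mem_insert.mp hi with rfl | hi
    · exact hsub
    · exact hs i hi

/-- The part of `N` where the hyperplane `a` has not been inverted. -/
theorem restrict_saturation (H : IsLocalizedVacuum F S h (insert a s) δ)
    (hsub : ¬ F.flat S ⊆ zeros (h a)) :
    IsLocalizedVacuum F S h s
      (⟨δ, le_saturation _ _ (Submodule.mem_span_singleton_self δ)⟩ :
        saturation (Submodule.span (WeylAlgebra K n) {δ}) (∏ i ∈ s, h i)) where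
  vacuum i := Subtype.ext (H.vacuum i)
  bijective i hi := by
    have hb := H.bijective i (Finset.mem_insert_of_mem hi)
    constructor
    · intro m m' hm
      exact Subtype.ext (hb.1 (congrArg Subtype.val hm))
    · intro m
      obtain ⟨u, hu⟩ := hb.2 m
      refine ⟨⟨u, mem_saturation_of_smul_mem (Finset.dvd_prod_of_mem h hi) ?_⟩, Subtype.ext hu⟩
      simp only at hu
      rw [hu]
      exact m.2
  mem_saturation m := by
    obtain ⟨k, hk⟩ := m.2
    obtain ⟨P, hP⟩ := Submodule.mem_span_singleton.mp hk
    exact ⟨k, Submodule.mem_span_singleton.mpr ⟨P, Subtype.ext hP⟩⟩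
  ne_zero hs h0 := H.ne_zero (fun i hi => by
    rcases Finset.mem_insert.mp hi with rfl | hi
    · exact hsub
    · exact hs i hi) (congrArg Subtype.val h0)

end IsLocalizedVacuum

namespace IsLocalizedVacuum

variable {K : Type*} [Field K] {n : ℕ} {ι : Type*} {N : Type*}
    [AddCommGroup N] [Module (WeylAlgebra K n) N] {F : AffineFrame K n} {S : Finset (Fin n)}
    {h : ι → MvPolynomial (Fin n) K} {s : Finset ι} {δ : N} [DecidableEq ι] {a : ι}
    {α : Fin n → K} {t : K} {j : Fin n} {F' : AffineFrame K n} {η : N}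

/-- If the vector field `w_j` kills `δ` and `w_j h = α_j` is a nonzero constant, then applying `w_j`
repeatedly to `h⁻¹ δ` produces all higher poles. -/
theorem mem_span_of_pow_smul_eq [CharZero K] (H : IsLocalizedVacuum F S h (insert a s) δ)
    (hh : h a = ∑ i, C (α i) * F.coord i + C t) (hj : j ∉ S) (hα : α j ≠ 0)
    (hη : ofPoly (h a) • η = δ) (k : ℕ) (u : N) (hu : ofPoly (h a ^ k) • u = δ) :
    u ∈ Submodule.span (WeylAlgebra K n) {η} := by
  have hderiv : F.deriv j (h a) = C (α j) := by
    rw [hh, map_add, map_sum, ← algebraMap_eq, Derivation.map_algebraMap, add_zero]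
    simp [Derivation.leibniz, AffineFrame.deriv_coord, ← algebraMap_eq]
  have hinj := (H.bijective a (Finset.mem_insert_self a s)).1
  have hinjk : ∀ k : ℕ, Function.Injective fun m : N => ofPoly (h a ^ k) • m := by
    intro k
    have := prod_pow_smul_injective (N := N) (h := h) (s := {a})
      (fun i hi => by rw [Finset.mem_singleton.mp hi]; exact hinj) k
    simpa using this
  induction k generalizing u with
  | zero =>
    rw [pow_zero, map_one, one_smul] at hu
    rw [hu, ← hη]
    exact Submodule.smul_mem _ _ (Submodule.mem_span_singleton_self η)
  | succ k ih =>
    cases k with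
    | zero =>
      have : u = η := hinj (by simpa [hη] using hu)
      rw [this]
      exact Submodule.mem_span_singleton_self η
    | succ k =>
      have hmem := ih (ofPoly (h a) • u) (by rwa [pow_succ, map_mul, mul_smul] at hu)
      have hcomm : ∀ (p : MvPolynomial (Fin n) K) (m : N),
          F.vec j • ofPoly p • m = ofPoly p • F.vec j • m + ofPoly (F.deriv j p) • m := by
        intro p m
        rw [smul_smul, AffineFrame.vec_mul_ofPoly, add_smul, mul_smul]
      -- With `u = h⁻ᵏ⁻² δ`, this is `w_j (h⁻ᵏ⁻¹ δ) = -(k + 1) α_j h⁻ᵏ⁻² δ`, multiplied by a power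
      -- of `h` to clear the denominators.
      have h1 := hcomm (h a ^ (k + 1 + 1)) u
      rw [hu, H.vacuum.vec_smul hj, Derivation.leibniz_pow, Nat.add_sub_cancel, hderiv,
        smul_eq_mul, pow_succ, ← mul_smul_comm, map_mul, map_mul, mul_smul, mul_smul,
        ← smul_add] at h1
      have h2 : ofPoly (h a) • F.vec j • u +
          ofPoly ((k + 1 + 1) • (C (α j) : MvPolynomial (Fin n) K)) • u = 0 :=
        hinjk (k + 1) (by simpa using h1.symm)
      have h3 : F.vec j • ofPoly (h a) • u =
          -(ofPoly (C ((k + 1 : K) * α j) : MvPolynomial (Fin n) K) • u) := by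
        rw [hcomm, hderiv, eq_neg_iff_add_eq_zero, ← h2, add_assoc, ← add_smul, ← map_add]
        congr 3
        rw [← map_add, ← map_nsmul]
        congr 1
        simp only [nsmul_eq_mul]
        push_cast
        ring
      have hne : (k + 1 : K) * α j ≠ 0 := mul_ne_zero (Nat.cast_add_one_ne_zero k) hα
      have h4 : u = -(ofPoly (C ((k + 1 : K) * α j)⁻¹ : MvPolynomial (Fin n) K) •
          F.vec j • ofPoly (h a) • u) := by
        rw [h3, smul_neg, neg_neg, smul_smul, ← map_mul, ← C_mul, inv_mul_cancel₀ hne, C_1,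
          map_one, one_smul]
      rw [h4]
      exact Submodule.neg_mem _ (Submodule.smul_mem _ _ (Submodule.smul_mem _ _ hmem))

/-- The class of `h⁻¹ δ` is nonzero: otherwise `fᵏ δ = h m` with `m ∈ D δ`, so that `f` vanishes on
the intersection of the flat with the hyperplane `h = 0`. -/
theorem notMem_saturation [CharZero K] (H : IsLocalizedVacuum F S h (insert a s) δ)
    (hh : h a = ∑ i, C (α i) * F.coord i + C t) (hsub : ¬ F.flat S ⊆ zeros (h a))
    (hη : ofPoly (h a) • η = δ) {S' : Finset (Fin n)}
    (hflat : F'.flat S' = F.flat S ∩ zeros (h a))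
    (hs : ∀ i ∈ s, ¬ F'.flat S' ⊆ zeros (h i)) :
    η ∉ saturation (Submodule.span (WeylAlgebra K n) {δ}) (∏ i ∈ s, h i) := by
  rintro ⟨k, hk⟩
  have hinj := (H.bijective a (Finset.mem_insert_self a s)).1
  have hδ0 : δ ≠ 0 := by
    refine H.ne_zero fun i hi => ?_
    rcases Finset.mem_insert.mp hi with rfl | hi
    · exact hsub
    · exact fun hle => hs i hi (hflat.le.trans (Set.inter_subset_left.trans hle))
  obtain ⟨p, hp⟩ := H.vacuum.exists_fock_smul_eq hk
  -- The restriction of `h a` to the flat, in the coordinates of the flat.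
  let q : MvPolynomial (Fin n) K := ∑ i, C (α i) * (if i ∈ S then 0 else X i) + C t
  have hcoord : ∀ i ∈ S, ofPoly (F.coord i) • η = 0 := by
    intro i hi
    refine hinj ?_
    simp only [smul_zero]
    rw [ofPoly_smul_comm, hη, H.vacuum.coord_smul hi]
  -- The coordinates `yᵢ` with `i ∈ S` kill `p(b) δ = fᵏ η`, so only the part `q` of `h a` acts.
  have h1 : ofPoly (h a) • F.fock S p • δ = F.fock S (q * p) • δ := by
    rw [map_mul, mul_smul]
    simp only [q, hh, map_add, map_sum, add_smul, Finset.sum_smul, map_mul, mul_smul, ofPoly_C,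
      F.fock_C]
    congr 1
    refine Finset.sum_congr rfl fun i _ => ?_
    split_ifs with hi
    · rw [hp, ofPoly_smul_comm, hcoord i hi, smul_zero, map_zero, zero_smul]
    · rw [F.fock_X, AffineFrame.raise, if_neg hi]
  have h2 : F.restrict S ((∏ i ∈ s, h i) ^ k) = q * p := by
    refine H.vacuum.fock_smul_injective hδ0 ?_
    rw [← H.vacuum.ofPoly_smul, ← h1, hp, ofPoly_smul_comm, hη]
  have h3 : F'.restrict S' (∏ i ∈ s, h i) = 0 := by
    rw [AffineFrame.restrict_eq_zero_iff]
    intro v hv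
    rw [hflat] at hv
    refine eq_zero_of_pow_eq_zero (n := k) ?_
    rw [← map_pow, ← F.eval_restrict_of_mem S hv.1, h2, map_mul]
    have hq : eval (fun i => eval v (F.coord i)) q = eval v (h a) := by
      simp only [q, hh, map_add, map_sum, map_mul, eval_C]
      congr 1
      refine Finset.sum_congr rfl fun i _ => ?_
      split_ifs with hi
      · rw [hv.1 i hi, map_zero]
      · rw [eval_X]
    have h0 : eval v (h a) = 0 := hv.2
    rw [hq, h0, zero_mul]
  -- The coordinate ring of the smaller flat is a domain.
  rw [map_prod, Finset.prod_eq_zero_iff] at h3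
  obtain ⟨i, hi, h0⟩ := h3
  exact hs i hi ((F'.restrict_eq_zero_iff S').mp h0)

/-- The poles of `N` along a transversal hyperplane form a module of the same kind, supported on
the intersection of the flat with the hyperplane. -/
theorem quotient_saturation [CharZero K] (ha : a ∉ s)
    (H : IsLocalizedVacuum F S h (insert a s) δ)
    (hh : h a = ∑ i, C (α i) * F.coord i + C t) (hj : j ∉ S) (hα : α j ≠ 0)
    (hsub : ¬ F.flat S ⊆ zeros (h a)) (hη : ofPoly (h a) • η = δ)
    (hcoord_self : F'.coord j = h a) (hcoord : ∀ i ≠ j, F'.coord i = F.coord i)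
    (hvec : ∀ i ≠ j, F'.vec i = F.vec i - algebraMap K _ (α i / α j) * F.vec j)
    (hflat : F'.flat (insert j S) = F.flat S ∩ zeros (h a)) :
    IsLocalizedVacuum F' (insert j S) h s
      ((saturation (Submodule.span (WeylAlgebra K n) {δ}) (∏ i ∈ s, h i)).mkQ η) where
  vacuum := by
    have hinj := (H.bijective a (Finset.mem_insert_self a s)).1
    rw [AffineFrame.isVacuum_iff]
    constructor
    · intro i hi
      rw [← map_smul]
      rcases Finset.mem_insert.mp hi with rfl | hi
      · rw [hcoord_self, hη, Submodule.mkQ_apply, Submodule.Quotient.mk_eq_zero]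
        exact le_saturation _ _ (Submodule.mem_span_singleton_self δ)
      · have hij : i ≠ j := fun h => hj (h ▸ hi)
        rw [hcoord i hij]
        have : ofPoly (F.coord i) • η = 0 := by
          refine hinj ?_
          simp only [smul_zero]
          rw [ofPoly_smul_comm, hη, H.vacuum.coord_smul hi]
        rw [this, map_zero]
    · intro i hi
      rw [Finset.mem_insert, not_or] at hi
      rw [← map_smul]
      have hδ : F'.vec i • δ = 0 := by
        rw [hvec i hi.1, sub_smul, mul_smul, H.vacuum.vec_smul hi.2, H.vacuum.vec_smul hj,
          smul_zero, sub_zero]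
      have : F'.vec i • η = 0 := by
        refine hinj ?_
        simp only [smul_zero]
        have h1 : F'.vec i • ofPoly (h a) • η = ofPoly (h a) • F'.vec i • η := by
          rw [smul_smul, AffineFrame.vec_mul_ofPoly, ← hcoord_self, AffineFrame.deriv_coord,
            if_neg hi.1, map_zero, add_zero, mul_smul]
        rw [← h1, hη, hδ]
      rw [this, map_zero]
  bijective i hi := by
    have hb := H.bijective i (Finset.mem_insert_of_mem hi)
    constructor
    · intro m m' hm
      obtain ⟨u, rfl⟩ := Submodule.mkQ_surjective _ m
      obtain ⟨u', rfl⟩ := Submodule.mkQ_surjective _ m'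
      simp only [← map_smul] at hm
      rw [← sub_eq_zero, ← map_sub, Submodule.mkQ_apply, Submodule.Quotient.mk_eq_zero] at hm ⊢
      rw [← smul_sub] at hm
      exact mem_saturation_of_smul_mem (Finset.dvd_prod_of_mem h hi) hm
    · intro m
      obtain ⟨u, rfl⟩ := Submodule.mkQ_surjective _ m
      obtain ⟨v, hv⟩ := hb.2 u
      refine ⟨Submodule.mkQ _ v, ?_⟩
      simp only at hv ⊢
      rw [← map_smul, hv]
  mem_saturation m := by
    obtain ⟨u, rfl⟩ := Submodule.mkQ_surjective _ m
    obtain ⟨k, hk⟩ := H.mem_saturation_of_forall_mem ha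
      (H.mem_span_of_pow_smul_eq hh hj hα hη) u
    obtain ⟨P, hP⟩ := Submodule.mem_span_singleton.mp hk
    refine ⟨k, Submodule.mem_span_singleton.mpr ⟨P, ?_⟩⟩
    rw [← map_smul, ← map_smul, hP]
  ne_zero hs := by
    rw [Submodule.mkQ_apply, ne_eq, Submodule.Quotient.mk_eq_zero]
    exact H.notMem_saturation hh hsub hη hflat hs

end IsLocalizedVacuum

universe u

/-- The length of a localized vacuum module, by deletion and restriction. -/
theorem exists_length_eq_flatSum {K : Type*} [Field K] [CharZero K] {n : ℕ} {ι : Type*}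
    {h : ι → MvPolynomial (Fin n) K} (hdeg : ∀ i, (h i).totalDegree ≤ 1) (s : Finset ι) :
    ∀ (N : Type u) [AddCommGroup N] [Module (WeylAlgebra K n) N] (F : AffineFrame K n)
      (S : Finset (Fin n)) (δ : N), IsLocalizedVacuum F S h s δ →
      ∃ ℓ : ℕ, Module.length (WeylAlgebra K n) N = (ℓ : ℕ∞) ∧
        (ℓ : ℤ) = (-1) ^ S.card * flatSum h Set.Nonempty (F.flat S) s := by
  classical
  induction s using Finset.induction_on with
  | empty =>
    intro N _ _ F S δ H
    refine ⟨1, by simpa using H.length_of_empty, ?_⟩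
    rw [flatSum_empty, if_pos (F.flat_nonempty S), AffineFrame.finrank_quotient_vectorSpan_flat,
      ← mul_pow]
    simp
  | insert a s ha ih =>
    intro N _ _ F S δ H
    obtain ⟨α, t, hh⟩ := F.exists_eq_of_totalDegree_le_one (hdeg a)
    rw [flatSum_insert h _ _ ha]
    rcases F.flat_trichotomy S hh with ⟨hα, ht, he⟩ | ⟨hα, ht, he⟩ |
      ⟨j, hj, hα, hsub, F', h1, h2, h3, he⟩
    · have := H.subsingleton (by
        rw [IsLocalizedVacuum.smul_vacuum_of_const H.vacuum hh hα, ht, map_zero, zero_smul])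
      exact ⟨0, by simp [Module.length_eq_zero], by simp [he]⟩
    · have hsub : ¬ F.flat S ⊆ zeros (h a) := by
        intro hle
        rw [Set.inter_eq_left.mpr hle] at he
        exact (F.flat_nonempty S).ne_empty he
      have H' := H.of_insert ha ht
        (IsLocalizedVacuum.smul_vacuum_of_const H.vacuum hh hα) hsub
      rw [he, flatSum_empty_set h Set.not_nonempty_empty, sub_zero]
      exact ih N F S δ H'
    · obtain ⟨η, hη⟩ := (H.bijective a (Finset.mem_insert_self a s)).2 δ
      obtain ⟨ℓ₁, hℓ₁, hc₁⟩ := ih _ F S _ (H.restrict_saturation hsub)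
      obtain ⟨ℓ₂, hℓ₂, hc₂⟩ := ih _ F' (insert j S) _
        (H.quotient_saturation ha hh hj hα hsub hη h1 h2 h3 he)
      refine ⟨ℓ₁ + ℓ₂, ?_, ?_⟩
      · rw [Module.length_eq_add_of_exact
          (saturation (Submodule.span (WeylAlgebra K n) {δ}) (∏ i ∈ s, h i)).subtype
          (saturation (Submodule.span (WeylAlgebra K n) {δ}) (∏ i ∈ s, h i)).mkQ
          (Submodule.subtype_injective _) (Submodule.mkQ_surjective _)
          (LinearMap.exact_subtype_mkQ _), hℓ₁, hℓ₂, Nat.cast_add]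
      · rw [Nat.cast_add, hc₁, hc₂, he, Finset.card_insert_of_notMem hj]
        ring

/-! ### Möbius function of the intersection poset -/

section Moebius

variable {K : Type*} [Field K] {n : ℕ} {ι : Type*} {h : ι → MvPolynomial (Fin n) K}

/-- A non-empty intersection of hyperplanes as an element of the intersection poset. -/
def IntersectionPoset.ofFinset (B : Finset ι) (hB : (⋂ i ∈ B, zeros (h i)).Nonempty) :
    IntersectionPoset (arrangement h) :=
  ⟨⋂ i ∈ B, zeros (h i), hB, (fun i => zeros (h i)) '' B, by
    rintro _ ⟨i, -, rfl⟩
    exact ⟨i, rfl⟩, by rw [Set.sInter_image]; rfl⟩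

theorem IntersectionPoset.eq_bot_iff_forall_not_subset [Infinite K] (hne : ∀ i, h i ≠ 0)
    (Y : IntersectionPoset (arrangement h)) : Y = ⊥ ↔ ∀ i, ¬ Y.1 ⊆ zeros (h i) := by
  constructor
  · rintro rfl i hi
    refine hne i (MvPolynomial.funext fun v => ?_)
    rw [map_zero]
    exact hi (Set.mem_univ v)
  · intro hY
    obtain ⟨Y, hYne, S, hS, rfl⟩ := Y
    refine Subtype.ext ?_
    change ⋂₀ S = Set.univ
    rw [Set.sInter_eq_univ]
    intro H hH
    obtain ⟨i, rfl⟩ := hS hH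
    exact absurd (Set.sInter_subset_of_mem hH) (hY i)

variable [Fintype ι]

open Classical in
/-- Whitney's theorem: the Möbius function of the intersection poset counts with signs the sets of
hyperplanes with a given intersection. -/
theorem IntersectionPoset.moebius_eq_sum [Infinite K] (hne : ∀ i, h i ≠ 0)
    (Y : IntersectionPoset (arrangement h)) :
    Y.moebius = ∑ B : Finset ι, if ⋂ i ∈ B, zeros (h i) = Y.1 then (-1) ^ B.card else 0 := by
  have hsum : ∀ Y : IntersectionPoset (arrangement h), (if Y = ⊥ then (1 : ℤ) else 0) =
      ∑ Z ∈ Finset.Iic Y, ∑ B : Finset ι,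
        if ⋂ i ∈ B, zeros (h i) = Z.1 then (-1) ^ B.card else 0 := by
    intro Y
    rw [Finset.sum_comm]
    have hinner : ∀ B : Finset ι, (∑ Z ∈ Finset.Iic Y,
        if ⋂ i ∈ B, zeros (h i) = Z.1 then (-1 : ℤ) ^ B.card else 0) =
        if B ∈ (Finset.univ.filter fun i => Y.1 ⊆ zeros (h i)).powerset then
          (-1) ^ B.card else 0 := by
      intro B
      have hiff : B ∈ (Finset.univ.filter fun i => Y.1 ⊆ zeros (h i)).powerset ↔
          Y.1 ⊆ ⋂ i ∈ B, zeros (h i) := by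
        simp [Finset.subset_iff]
      split_ifs with hB
      · rw [hiff] at hB
        -- `⋂ B` contains `Y`, so it is non-empty and is the only element of the poset to count.
        rw [Finset.sum_eq_single (ofFinset B (Y.2.1.mono hB))]
        · exact if_pos rfl
        · intro Z _ hZ
          exact if_neg fun h => hZ (Subtype.ext h.symm)
        · intro hZ
          exact absurd (Finset.mem_Iic.mpr (IntersectionPoset.le_iff _ |>.mpr hB)) hZ
      · refine Finset.sum_eq_zero fun Z hZ => if_neg fun h => hB ?_
        rw [hiff, h]
        exact (IntersectionPoset.le_iff _).mp (Finset.mem_Iic.mp hZ)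
    rw [Finset.sum_congr rfl fun B _ => hinner B, Finset.sum_ite_mem, Finset.univ_inter,
      Finset.sum_powerset_neg_one_pow_card]
    refine if_congr ?_ rfl rfl
    rw [Y.eq_bot_iff_forall_not_subset hne, Finset.filter_eq_empty_iff]
    simp
  have := IncidenceAlgebra.moebius_inversion_bot _ _ hsum Y
  rw [this, Finset.sum_eq_single ⊥]
  · rw [if_pos rfl, mul_one]
    rfl
  · intro Z _ hZ
    rw [if_neg hZ, mul_zero]
  · intro hbot
    exact absurd (Finset.mem_Iic.mpr bot_le) hbot

theorem IntersectionPoset.flatSum_eq [Infinite K] (hne : ∀ i, h i ≠ 0)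
    (Y : IntersectionPoset (arrangement h)) :
    flatSum h (· = Y.1) Set.univ Finset.univ = Y.moebius * (-1) ^ Y.codim K := by
  classical
  rw [Y.moebius_eq_sum hne, Finset.sum_mul, flatSum, Finset.powerset_univ]
  refine Finset.sum_congr rfl fun B _ => ?_
  rw [Set.univ_inter]
  split_ifs with hB
  · rw [hB, pow_add, IntersectionPoset.codim]
  · rw [zero_mul]

theorem flatSum_nonempty_eq_sum (h : ι → MvPolynomial (Fin n) K) :
    flatSum h Set.Nonempty Set.univ Finset.univ =
      ∑ Y : IntersectionPoset (arrangement h), flatSum h (· = Y.1) Set.univ Finset.univ := by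
  classical
  simp only [flatSum, Set.univ_inter]
  rw [Finset.sum_comm]
  refine Finset.sum_congr rfl fun B _ => ?_
  split_ifs with hB
  · rw [Finset.sum_eq_single (IntersectionPoset.ofFinset B hB)]
    · exact (if_pos rfl).symm
    · intro Z _ hZ
      exact if_neg fun h => hZ (Subtype.ext h.symm)
    · intro hZ
      exact absurd (Finset.mem_univ _) hZ
  · refine (Finset.sum_eq_zero fun Z _ => if_neg fun h => hB ?_).symm
    rw [h]
    exact Z.2.1

theorem AffineFrame.flat_empty (F : AffineFrame K n) : F.flat ∅ = Set.univ := by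
  simp [flat]

/-- The Möbius function alternates in sign with the codimension. -/
theorem IntersectionPoset.moebius_mul_neg_one_pow [Infinite K]
    (hdeg : ∀ i, (h i).totalDegree = 1) (hne : ∀ i, h i ≠ 0)
    (Y : IntersectionPoset (arrangement h)) : Y.moebius * (-1) ^ Y.codim K = |Y.moebius| := by
  have h0 := AffineFrame.neg_one_pow_card_mul_flatSum_nonneg (fun i => (hdeg i).le)
    (P := (· = Y.1)) (fun he => Y.2.1.ne_empty he.symm) Finset.univ (AffineFrame.standard K n) ∅
  rw [AffineFrame.flat_empty, Finset.card_empty, pow_zero, one_mul, Y.flatSum_eq hne] at h0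
  rw [← abs_of_nonneg h0, abs_mul, abs_neg_one_pow, mul_one]

theorem eval_one_poincarePolynomial (K : Type*) {V : Type*} [Field K] [AddCommGroup V]
    [Module K V] (A : Set (Set V)) [Finite A] : (poincarePolynomial K A).eval 1 =
      ∑ X : IntersectionPoset A, X.moebius * (-1) ^ X.codim K := by
  simp [poincarePolynomial, Polynomial.eval_finsetSum]

end Moebius

/-! ### The localization as a module over the Weyl algebra -/

section Localization

variable {K : Type*} [Field K] {n : ℕ} (f : MvPolynomial (Fin n) K)

theorem ofPoly_smul_localization (p : MvPolynomial (Fin n) K) (u : Localization.Away f) :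
    ofPoly p • u = algebraMap _ (Localization.Away f) p * u := by
  induction p using MvPolynomial.induction_on generalizing u with
  | C c =>
    rw [ofPoly_C, weyl_smul_def, AlgHom.commutes, Module.algebraMap_end_apply, Algebra.smul_def,
      IsScalarTower.algebraMap_apply K (MvPolynomial (Fin n) K) (Localization.Away f),
      algebraMap_eq]
  | add p q hp hq => rw [map_add, add_smul, hp, hq, map_add, add_mul]
  | mul_X p i hp => rw [map_mul, mul_smul, ofPoly_X, x_smul, hp, map_mul, mul_assoc]

theorem polynomialSubmodule_eq_span :
    polynomialSubmodule f = Submodule.span (WeylAlgebra K n) {(1 : Localization.Away f)} := by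
  refine le_antisymm ?_ ?_
  · rintro _ ⟨p, rfl⟩
    exact Submodule.mem_span_singleton.mpr
      ⟨ofPoly p, by rw [ofPoly_smul_localization, mul_one]⟩
  · rw [Submodule.span_singleton_le_iff_mem]
    exact ⟨1, map_one _⟩

/-- The function `1` is the delta function of the whole space. -/
theorem isVacuum_one :
    (AffineFrame.standard K n).IsVacuum ∅ (1 : Localization.Away f) := by
  rw [AffineFrame.isVacuum_iff]
  refine ⟨by simp, fun i _ => ?_⟩
  rw [AffineFrame.vec, Finset.sum_smul]
  refine Finset.sum_eq_zero fun j _ => ?_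
  rw [mul_smul, d_smul, Derivation.map_one_eq_zero, smul_zero]

theorem isLocalizedVacuum_one {ι : Type*} [Fintype ι] (h : ι → MvPolynomial (Fin n) K)
    (hne : ∀ i, h i ≠ 0) :
    IsLocalizedVacuum (AffineFrame.standard K n) ∅ h Finset.univ
      (1 : Localization.Away (∏ i, h i)) where
  vacuum := isVacuum_one _
  bijective i _ := by
    have hu : IsUnit (algebraMap _ (Localization.Away (∏ i, h i)) (h i)) :=
      isUnit_of_dvd_unit (map_dvd _ (Finset.dvd_prod_of_mem h (Finset.mem_univ i)))
        (IsLocalization.Away.algebraMap_isUnit (∏ i, h i))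
    simp only [ofPoly_smul_localization]
    exact IsUnit.isUnit_iff_mulLeft_bijective.mp hu
  mem_saturation m := by
    obtain ⟨k, p, hp⟩ := IsLocalization.Away.surj (∏ i, h i) m
    refine ⟨k, Submodule.mem_span_singleton.mpr ⟨ofPoly p, ?_⟩⟩
    rw [ofPoly_smul_localization, ofPoly_smul_localization, mul_one, map_pow, ← hp, mul_comm]
  ne_zero _ := by
    have hf : ∏ i, h i ≠ 0 := Finset.prod_ne_zero_iff.mpr fun i _ => hne i
    have := (IsLocalization.injective (Localization.Away (∏ i, h i))
      (powers_le_nonZeroDivisors_of_noZeroDivisors hf)).nontrivial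
    exact one_ne_zero

end Localization

theorem mainTheorem1 {K : Type*} [Field K] [CharZero K] {n : ℕ} {ι : Type*} [Fintype ι]
    (h : ι → MvPolynomial (Fin n) K) (hdeg : ∀ i, (h i).totalDegree = 1)
    (hdist : ∀ i j, i ≠ j → ¬ Associated (h i) (h j)) :
    ∃ ℓ : ℕ, Module.length (WeylAlgebra K n) (FirstLocalCohomology (∏ i, h i)) = (ℓ : ℕ∞) ∧
      (ℓ : ℤ) = (poincarePolynomial K (arrangement h)).eval 1 - 1 ∧
      (poincarePolynomial K (arrangement h)).eval 1 - 1 =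
        ∑ X : IntersectionPoset (arrangement h) with X ≠ ⊥, |X.moebius| := by
  have hne : ∀ i, h i ≠ 0 := by
    intro i h0
    have := hdeg i
    rw [h0, totalDegree_zero] at this
    exact zero_ne_one this
  have H := isLocalizedVacuum_one h hne
  obtain ⟨ℓ, hℓ, hcount⟩ := exists_length_eq_flatSum (fun i => (hdeg i).le) Finset.univ
    (Localization.Away (∏ i, h i)) _ _ _ H
  have hpi : (ℓ : ℤ) = (poincarePolynomial K (arrangement h)).eval 1 := by
    rw [hcount, AffineFrame.flat_empty, Finset.card_empty, pow_zero, one_mul,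
      flatSum_nonempty_eq_sum, eval_one_poincarePolynomial]
    exact Finset.sum_congr rfl fun Y _ => Y.flatSum_eq hne
  have hR : Module.length (WeylAlgebra K n) (polynomialSubmodule (∏ i, h i)) = 1 := by
    rw [Module.length_eq_one_iff, polynomialSubmodule_eq_span]
    exact H.vacuum.isSimpleModule_span (H.ne_zero fun i _ hle => by
      refine hne i (MvPolynomial.funext fun v => ?_)
      rw [map_zero]
      exact hle (by rw [AffineFrame.flat_empty]; trivial))
  have hadd := Module.length_eq_add_of_exact (polynomialSubmodule (∏ i, h i)).subtype
    (polynomialSubmodule (∏ i, h i)).mkQ (Submodule.subtype_injective _)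
    (Submodule.mkQ_surjective _) (LinearMap.exact_subtype_mkQ _)
  rw [hℓ, hR] at hadd
  have hfin : Module.length (WeylAlgebra K n) (FirstLocalCohomology (∏ i, h i)) ≠ ⊤ := by
    intro htop
    rw [htop] at hadd
    simp at hadd
  obtain ⟨ℓ', hℓ'⟩ := ENat.ne_top_iff_exists.mp hfin
  refine ⟨ℓ', hℓ'.symm, ?_, ?_⟩
  · rw [← hℓ'] at hadd
    have : ℓ = 1 + ℓ' := by exact_mod_cast hadd
    rw [← hpi, this]
    push_cast
    ring
  · rw [eval_one_poincarePolynomial,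
      Finset.sum_congr rfl fun Y _ => Y.moebius_mul_neg_one_pow hdeg hne, Finset.filter_ne',
      ← Finset.add_sum_erase _ _ (Finset.mem_univ (⊥ : IntersectionPoset (arrangement h)))]
    simp [IntersectionPoset.moebius]
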